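/- Let $L$ be a (many-sorted) metric signature of continuous logic and $T$ an $L$-theory. $L$-structures have nonempty complete metric spaces of bounded diameter (bounds given by $L$) as sorts; models of $T$ are those in which every sentence of $T$ has value $0$. For a finite tuple of variables $\vec x$, let $\mathbf M^{\vec x}$ be the corresponding product of sorts, with the maximum metric $d$. $L$-formulae are built from atomic formulae by arbitrary continuous connectives $\mathbb R^k\to\mathbb R$ and the quantifiers $\sup$, $\inf$. A *$T$-formula* over $\vec x$ is an element $\varphi$ of the completion of the set of $L$-formulae in $\vec x$ under the pseudometric $d(\varphi,\psi)=\sup\{|\varphi^{\mathbf M}(\vec a)-\psi^{\mathbf M}(\vec a)|:\mathbf M\models T,\ \vec a\in\mathbf M^{\vec x}\}$; its interpretation $\varphi^{\mathbf M}:\mathbf M^{\vec x}\to\mathbb R$ is the limit of the interpretations of approximating $L$-formulae. A real-valued function $\Phi(\mathbf M,\vec a)$ of models $\mathbf M\models T$ and $\vec a\in\mathbf M^{\vec x}$ is *realized* by $\varphi$ if $\Phi(\mathbf M,\vec a)=\varphi^{\mathbf M}(\vec a)$ for all $(\mathbf M,\vec a)$. A $T$-formula $\varphi$ is *nonnegative*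 if $\varphi^{\mathbf M}\ge 0$ for all $\mathbf M\models T$. It is *almost-near* if it is nonnegative and for every $\epsilon>0$ there is $\delta>0$ such that for all $\mathbf M\models T$ and $\vec a\in\mathbf M^{\vec x}$ with $\varphi^{\mathbf M}(\vec a)<\delta$ there is $\vec b\in\mathbf M^{\vec x}$ with $d(\vec a,\vec b)\le\epsilon$ and $\varphi^{\mathbf M}(\vec b)=0$. A *$T$-functor* $X$ over $\vec x$ assigns to each $\mathbf M\models T$ a closed subset $X(\mathbf M)\subseteq\mathbf M^{\vec x}$ such that every elementary embedding $\mathbf M\to\mathbf N$ of models of $T$ maps $X(\mathbf M)$ into $X(\mathbf N)$. Write $X=Z(\varphi)$ if $X(\mathbf M)=\{\vec a\in\mathbf M^{\vec x}:\varphi^{\mathbf M}(\vec a)=0\}$ for all $\mathbf M\models T$; $X$ is a *zeroset* if $X=Z(\varphi)$ for some $T$-formula $\varphi$. Where $X(\mathbf M)=\emptyset$, suprema over $X(\mathbf M)$ are read as a fixed real constant, and infima over $X(\mathbf M)$, including the distance $d(\vec a,X(\mathbf M))=\inf_{\vec b\in X(\mathbf M)}d(\vec a,\vec b)$, as a fixed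 positive real constant; the theorem holds for every choice of these two constants. **Theorem.** Let $X$ be a $T$-functor over $\vec x$. The following are equivalent: 1. For every finite tuple of variables $\vec y$ and every $T$-formula $\psi(\vec x,\vec y)$, the functions $\sup_{\vec x\in X}\psi(\vec x,\vec y)$ and $\inf_{\vec x\in X}\psi(\vec x,\vec y)$, which send $(\mathbf M,\vec b)$ to $\sup_{\vec a\in X(\mathbf M)}\psi^{\mathbf M}(\vec a,\vec b)$ and $\inf_{\vec a\in X(\mathbf M)}\psi^{\mathbf M}(\vec a,\vec b)$, are realized by $T$-formulae. 2. The function $(\mathbf M,\vec a)\mapsto d(\vec a,X(\mathbf M))$ is realized by a $T$-formula. 3. There is an almost-near $T$-formula $\varphi(\vec x)$ such that $X=Z(\varphi)$. 4. For all sets $I$, all families $(\mathbf M_i)_{i\in I}$ of models of $T$ and all ultrafilters $\mathcal U$ on $I$, $X(\prod_{\mathcal U}\mathbf M_i)=\prod_{\mathcal U}X(\mathbf M_i)$, where the right-hand side is the set of classes $(\vec a_i)^\bullet$ of families with $\vec a_i\in X(\mathbf M_i)$ for $\mathcal U$-almost all $i$. 5. (a) $X$ is a zeroset, and (b) every nonnegative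 $T$-formula $\varphi(\vec x)$ with $X=Z(\varphi)$ is almost-near. -/

import Mathlib

open Filter Topology Set

universe u

noncomputable section

namespace ContLogic

/-! ### Signatures, structures, terms and formulae of continuous logic -/

/-- A metric signature: sorts with diameter bounds; function symbols with arities and moduli of
uniform continuity; relation symbols with arities, compact value intervals and moduli of uniform
continuity. -/
structure Signature where
  Sorts : Type u
  bound : Sorts → ℝ
  Funcs : Type u
  farity : Funcs → ℕ
  fdom : (f : Funcs) → Fin (farity f) → Sorts
  fcod : Funcs → Sorts
  fmod : Funcs → ℝ → ℝ
  fmod_pos : ∀ f ε, 0 < ε → 0 < fmod f ε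
  Rels : Type u
  rarity : Rels → ℕ
  rdom : (R : Rels) → Fin (rarity R) → Sorts
  rlo : Rels → ℝ
  rhi : Rels → ℝ
  rlo_le_rhi : ∀ R, rlo R ≤ rhi R
  rmod : Rels → ℝ → ℝ
  rmod_pos : ∀ R ε, 0 < ε → 0 < rmod R ε

/-- An `L`-structure. Each sort is a nonempty complete metric space of diameter at most the bound
given by `L`; finite products of sorts carry the maximum metric. -/
structure Struc (L : Signature.{u}) where
  carrier : L.Sorts → Type u
  metric : ∀ S, MetricSpace (carrier S)
  complete : ∀ S, CompleteSpace (carrier S)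
  nonempty : ∀ S, Nonempty (carrier S)
  dist_le : ∀ S (a b : carrier S), dist a b ≤ L.bound S
  func : (f : L.Funcs) → ((i : Fin (L.farity f)) → carrier (L.fdom f i)) → carrier (L.fcod f)
  func_unif : ∀ f (ε : ℝ), 0 < ε → ∀ a b, dist a b < L.fmod f ε → dist (func f a) (func f b) ≤ ε
  rel : (R : L.Rels) → ((i : Fin (L.rarity R)) → carrier (L.rdom R i)) → ℝ
  rel_mem : ∀ R a, rel R a ∈ Icc (L.rlo R) (L.rhi R)
  rel_unif : ∀ R (ε : ℝ), 0 < ε → ∀ a b, dist a b < L.rmod R ε → dist (rel R a) (rel R b) ≤ ε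

attribute [instance] Struc.metric Struc.complete Struc.nonempty

variable {L : Signature.{u}}

/-- `M.Pt s` is the product of sorts `M^x`, for a tuple of variables `x` (indexed by `α`) whose
sorts are listed by `s`. -/
abbrev Struc.Pt (M : Struc L) {α : Type} (s : α → L.Sorts) : Type u :=
  (i : α) → M.carrier (s i)

/-- The concatenation `(a, b)` of two tuples. -/
def Struc.Pt.append {M : Struc L} {α β : Type} {s : α → L.Sorts} {t : β → L.Sorts}
    (a : M.Pt s) (b : M.Pt t) : M.Pt (Sum.elim s t)
  | Sum.inl i => a i
  | Sum.inr j => b j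

/-- Terms with free variables of sorts `s` and bound (de Bruijn) variables of sorts `Γ`, indexed by
the sort of their value. -/
inductive Term (L : Signature.{u}) {α : Type} (s : α → L.Sorts) (Γ : List L.Sorts) :
    L.Sorts → Type u
  | var (i : α) : Term L s Γ (s i)
  | bvar (j : Fin Γ.length) : Term L s Γ (Γ.get j)
  | func (f : L.Funcs) (ts : (i : Fin (L.farity f)) → Term L s Γ (L.fdom f i)) :
      Term L s Γ (L.fcod f)

/-- Formulae with free variables of sorts `s` and bound (de Bruijn) variables of sorts `Γ`: the
atomic ones, closed under all continuous connectives `ℝ^k → ℝ` and the quantifiers `sup`, `inf`. -/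
inductive BFormula (L : Signature.{u}) {α : Type} (s : α → L.Sorts) : List L.Sorts → Type u
  | rel {Γ : List L.Sorts} (R : L.Rels)
      (ts : (i : Fin (L.rarity R)) → Term L s Γ (L.rdom R i)) : BFormula L s Γ
  | dist {Γ : List L.Sorts} {S : L.Sorts} (t₁ t₂ : Term L s Γ S) : BFormula L s Γ
  | conn {Γ : List L.Sorts} {k : ℕ} (g : C(Fin k → ℝ, ℝ)) (φ : Fin k → BFormula L s Γ) :
      BFormula L s Γ
  | sup {Γ : List L.Sorts} (S : L.Sorts) (φ : BFormula L s (S :: Γ)) : BFormula L s Γ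
  | inf {Γ : List L.Sorts} (S : L.Sorts) (φ : BFormula L s (S :: Γ)) : BFormula L s Γ

/-- `L`-formulae whose free variables are among a tuple with sorts `s`. -/
abbrev Formula (L : Signature.{u}) {α : Type} (s : α → L.Sorts) : Type u := BFormula L s []

abbrev Sentence (L : Signature.{u}) : Type u := Formula L (Empty.elim : Empty → L.Sorts)

abbrev Theory (L : Signature.{u}) : Type u := Set (Sentence L)

section Semantics

variable {α : Type} {s : α → L.Sorts} (M : Struc L)

/-- Values for a list of bound variables. -/
abbrev Struc.Env (Γ : List L.Sorts) : Type u := (j : Fin Γ.length) → M.carrier (Γ.get j)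

variable {M} in
/-- Extend an environment by a value for a newly bound variable. -/
def Struc.Env.cons {Γ : List L.Sorts} {S : L.Sorts} (a : M.carrier S) (e : M.Env Γ) :
    M.Env (S :: Γ) :=
  Fin.cons (α := fun j : Fin (Γ.length + 1) => M.carrier ((S :: Γ).get j)) a e

def Struc.Env.nil : M.Env [] := fun j => j.elim0

def Term.eval {Γ : List L.Sorts} (v : M.Pt s) (e : M.Env Γ) :
    {S : L.Sorts} → Term L s Γ S → M.carrier S
  | _, .var i => v i
  | _, .bvar j => e j
  | _, .func f ts => M.func f fun i => (ts i).eval v e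

def BFormula.eval (v : M.Pt s) : {Γ : List L.Sorts} → BFormula L s Γ → M.Env Γ → ℝ
  | _, .rel R ts, e => M.rel R fun i => (ts i).eval M v e
  | _, .dist t₁ t₂, e => Dist.dist (t₁.eval M v e) (t₂.eval M v e)
  | _, .conn g φ, e => g fun i => (φ i).eval v e
  | _, .sup _ φ, e => ⨆ a, φ.eval v (Struc.Env.cons a e)
  | _, .inf _ φ, e => ⨅ a, φ.eval v (Struc.Env.cons a e)

/-- The interpretation `φ^M(a)` of a formula. -/
def Formula.interp (φ : Formula L s) (a : M.Pt s) : ℝ := BFormula.eval M a φ (Struc.Env.nil M)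

/-- `M ⊨ T`. -/
def Struc.Models (T : Theory L) : Prop :=
  ∀ σ ∈ T, Formula.interp M σ (fun i => i.elim) = 0

end Semantics

/-- The models of `T`. -/
structure Model (T : Theory L) where
  str : Struc L
  models : str.Models T

/-- Elementary embeddings: sortwise maps that preserve the values of all formulae. -/
structure ElemEmb (M N : Struc L) where
  toFun : (S : L.Sorts) → M.carrier S → N.carrier S
  elementary : ∀ (n : ℕ) (s : Fin n → L.Sorts) (φ : Formula L s) (a : M.Pt s),
    φ.interp N (fun i => toFun (s i) (a i)) = φ.interp M a

/-! ### Formulae are bounded, uniformly in the structure -/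

theorem BFormula.exists_bound {α : Type} {s : α → L.Sorts} {Γ : List L.Sorts}
    (φ : BFormula L s Γ) :
    ∃ B : ℝ, ∀ (M : Struc L) (v : M.Pt s) (e : M.Env Γ), |φ.eval M v e| ≤ B := by
  induction φ with
  | rel R ts =>
    refine ⟨max |L.rlo R| |L.rhi R|, fun M v e => ?_⟩
    have h := M.rel_mem R fun i => (ts i).eval M v e
    simp only [BFormula.eval]
    exact abs_le_max_abs_abs h.1 h.2
  | @dist Γ S t₁ t₂ =>
    refine ⟨L.bound S, fun M v e => ?_⟩
    simp only [BFormula.eval]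
    rw [abs_of_nonneg dist_nonneg]
    exact M.dist_le _ _ _
  | conn g φ ih =>
    choose B hB using ih
    have hK : IsCompact (Set.pi univ fun i => Icc (-(B i)) (B i)) :=
      isCompact_univ_pi fun i => isCompact_Icc
    obtain ⟨C, hC⟩ := hK.exists_bound_of_continuousOn (f := g) g.continuous.continuousOn
    refine ⟨C, fun M v e => ?_⟩
    simp only [BFormula.eval]
    exact hC _ fun i _ => abs_le.mp (hB i M v e)
  | sup S φ ih =>
    obtain ⟨B, hB⟩ := ih
    refine ⟨B, fun M v e => ?_⟩
    simp only [BFormula.eval]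
    have hb : BddAbove (range fun a => φ.eval M v (Struc.Env.cons a e)) :=
      ⟨B, by rintro _ ⟨a, rfl⟩; exact (abs_le.mp (hB M v _)).2⟩
    obtain ⟨a₀⟩ := M.nonempty S
    exact abs_le.mpr ⟨(abs_le.mp (hB M v (Struc.Env.cons a₀ e))).1.trans (le_ciSup hb a₀),
      ciSup_le fun a => (abs_le.mp (hB M v _)).2⟩
  | inf S φ ih =>
    obtain ⟨B, hB⟩ := ih
    refine ⟨B, fun M v e => ?_⟩
    simp only [BFormula.eval]
    have hb : BddBelow (range fun a => φ.eval M v (Struc.Env.cons a e)) :=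
      ⟨-B, by rintro _ ⟨a, rfl⟩; exact (abs_le.mp (hB M v _)).1⟩
    obtain ⟨a₀⟩ := M.nonempty S
    exact abs_le.mpr ⟨le_ciInf fun a => (abs_le.mp (hB M v _)).1,
      (ciInf_le hb a₀).trans (abs_le.mp (hB M v (Struc.Env.cons a₀ e))).2⟩

/-! ### Ultraproducts -/

section Ultraproduct

variable {I : Type u}

/-- The limit of a (bounded) real family along an ultrafilter. -/
def uLim (U : Ultrafilter I) (f : I → ℝ) : ℝ := limUnder (U : Filter I) f

theorem tendsto_uLim (U : Ultrafilter I) {f : I → ℝ} {B : ℝ} (h : ∀ i, |f i| ≤ B) :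
    Tendsto f U (𝓝 (uLim U f)) := by
  have hK : IsCompact (Icc (-B) B) := isCompact_Icc
  obtain ⟨x, -, hx⟩ := hK.ultrafilter_le_nhds (U.map f)
    (le_principal_iff.mpr (Ultrafilter.mem_map.mpr (Filter.univ_mem' fun i => abs_le.mp (h i))))
  exact tendsto_nhds_limUnder ⟨x, hx⟩

/-- The full product of one sort, before dividing by the ultraproduct pseudometric. -/
def UPre (_ : Ultrafilter I) (M : I → Struc L) (S : L.Sorts) : Type u :=
  (i : I) → (M i).carrier S

variable (U : Ultrafilter I) (M : I → Struc L)

instance (S : L.Sorts) : Dist (UPre U M S) := ⟨fun x y => uLim U fun i => dist (x i) (y i)⟩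

theorem UPre.tendsto_dist {S : L.Sorts} (x y : UPre U M S) :
    Tendsto (fun i => dist (x i) (y i)) U (𝓝 (dist x y)) :=
  tendsto_uLim U (B := L.bound S) fun i => by
    rw [abs_of_nonneg dist_nonneg]; exact (M i).dist_le _ _ _

instance (S : L.Sorts) : PseudoMetricSpace (UPre U M S) where
  dist_self x := tendsto_nhds_unique (UPre.tendsto_dist U M x x) (by simp)
  dist_comm x y := tendsto_nhds_unique (UPre.tendsto_dist U M x y)
    (by simpa only [dist_comm] using UPre.tendsto_dist U M y x)
  dist_triangle x y z := le_of_tendsto_of_tendsto' (UPre.tendsto_dist U M x z)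
    ((UPre.tendsto_dist U M x y).add (UPre.tendsto_dist U M y z)) fun _ => dist_triangle _ _ _

theorem UPre.completeSpace (S : L.Sorts) : CompleteSpace (UPre U M S) := by
  classical
  refine Metric.complete_of_convergent_controlled_sequences (fun N : ℕ => (2 : ℝ) / 2 / 2 ^ N)
    (fun N => by positivity) fun w hw => ?_
  let v : (i : I) → ℕ → (M i).carrier S := fun i k => Nat.rec (w 0 i)
    (fun k y => if dist y (w (k + 1) i) ≤ 2 / 2 / 2 ^ k then w (k + 1) i else y) k
  have hvs : ∀ i k, v i (k + 1) =
      if dist (v i k) (w (k + 1) i) ≤ 2 / 2 / 2 ^ k then w (k + 1) i else v i k :=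
    fun i k => rfl
  have hv : ∀ i k, dist (v i k) (v i (k + 1)) ≤ 2 / 2 / 2 ^ k := by
    intro i k
    rw [hvs]
    split_ifs with h
    · exact h
    · rw [dist_self]; positivity
  have hlim : ∀ i, ∃ y, Tendsto (v i) atTop (𝓝 y) := fun i =>
    cauchySeq_tendsto_of_complete (cauchySeq_of_le_geometric_two (hv i))
  choose y hy using hlim
  have hdist : ∀ i k, dist (v i k) (y i) ≤ 2 / 2 ^ k := fun i k =>
    dist_le_of_le_geometric_two_of_tendsto (hv i) (hy i) k
  have hagree : ∀ k, ∀ᶠ i in (U : Filter I), v i k = w k i := by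
    intro k
    induction k with
    | zero => exact Eventually.of_forall fun i => rfl
    | succ k ih =>
      have h1 := (UPre.tendsto_dist U M (w k) (w (k + 1))).eventually_lt_const
        (hw k k (k + 1) le_rfl (Nat.le_succ k))
      filter_upwards [ih, h1] with i hi h1
      rw [hvs, hi, if_pos h1.le]
  refine ⟨(y : UPre U M S), ?_⟩
  refine tendsto_iff_dist_tendsto_zero.mpr (squeeze_zero (fun _ => dist_nonneg)
    (g := fun k : ℕ => 2 / (2 : ℝ) ^ k) (fun k => ?_) ?_)
  · refine le_of_tendsto (UPre.tendsto_dist U M (w k) y) ?_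
    filter_upwards [hagree k] with i hi
    rw [← hi]
    exact hdist i k
  · simpa [div_eq_mul_inv] using
      (tendsto_pow_atTop_nhds_zero_of_lt_one (r := (2 : ℝ)⁻¹) (by norm_num)
        (by norm_num)).const_mul 2

/-- The underlying metric space of one sort of the ultraproduct: the quotient of the product by the
pseudometric `lim_U d(x_i, y_i)`. -/
abbrev UCarrier (S : L.Sorts) : Type u := SeparationQuotient (UPre U M S)

variable {M} in
/-- The class `(x_i)^•`. -/
def uMk {S : L.Sorts} (x : (i : I) → (M i).carrier S) : UCarrier U M S :=
  SeparationQuotient.mk (X := UPre U M S) x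

variable {U M} in
/-- A representing family of an element of the ultraproduct. -/
def uRep {S : L.Sorts} (q : UCarrier U M S) : (i : I) → (M i).carrier S :=
  Function.surjInv (SeparationQuotient.surjective_mk (X := UPre U M S)) q

theorem uMk_uRep {S : L.Sorts} (q : UCarrier U M S) : uMk U (uRep q) = q :=
  Function.surjInv_eq (SeparationQuotient.surjective_mk (X := UPre U M S)) q

theorem tendsto_dist_uMk {S : L.Sorts} (x y : (i : I) → (M i).carrier S) :
    Tendsto (fun i => dist (x i) (y i)) U (𝓝 (dist (uMk U x) (uMk U y))) := by
  rw [show dist (uMk U x) (uMk U y) = dist (α := UPre U M S) x y from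
    SeparationQuotient.dist_mk _ _]
  exact UPre.tendsto_dist U M x y

theorem eventually_dist_lt {α : Type} [Fintype α] {s : α → L.Sorts}
    (x y : (k : α) → (i : I) → (M i).carrier (s k)) {r : ℝ} (hr : 0 < r)
    (h : dist (fun k => uMk U (x k)) (fun k => uMk U (y k)) < r) :
    ∀ᶠ i in (U : Filter I), dist (fun k => x k i) (fun k => y k i) < r := by
  rw [dist_pi_lt_iff hr] at h
  have h' : ∀ᶠ i in (U : Filter I), ∀ k, dist (x k i) (y k i) < r :=
    Filter.eventually_all.mpr fun k => (tendsto_dist_uMk U M (x k) (y k)).eventually_lt_const (h k)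
  filter_upwards [h'] with i hi
  exact (dist_pi_lt_iff hr).mpr hi

theorem eventually_dist_lt_of_eq {α : Type} [Fintype α] {s : α → L.Sorts}
    (x y : (k : α) → (i : I) → (M i).carrier (s k)) {r : ℝ} (hr : 0 < r)
    (h : ∀ k, uMk U (x k) = uMk U (y k)) :
    ∀ᶠ i in (U : Filter I), dist (fun k => x k i) (fun k => y k i) < r :=
  eventually_dist_lt U M x y hr (by rw [funext h, dist_self]; exact hr)

/-- The relation `R` of the ultraproduct, on representatives, is a limit of bounded values. -/
theorem tendsto_rel (R : L.Rels) (x : (k : Fin (L.rarity R)) → (i : I) → (M i).carrier (L.rdom R k)) :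
    Tendsto (fun i => (M i).rel R fun k => x k i) U
      (𝓝 (uLim U fun i => (M i).rel R fun k => x k i)) :=
  tendsto_uLim U (B := max |L.rlo R| |L.rhi R|) fun i =>
    abs_le_max_abs_abs ((M i).rel_mem R _).1 ((M i).rel_mem R _).2

/-- The ultraproduct of a family of `L`-structures; symbols are interpreted coordinatewise on
representatives (the results do not depend on the representatives, see `ultraproduct_func` and
`ultraproduct_rel`). -/
def ultraproduct : Struc L where
  carrier := UCarrier U M
  metric _ := inferInstance
  complete S := by
    have := UPre.completeSpace U M S
    infer_instance
  nonempty _ := ⟨uMk U fun _ => Classical.arbitrary _⟩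
  dist_le S a b := by
    rw [← uMk_uRep U M a, ← uMk_uRep U M b]
    exact le_of_tendsto' (tendsto_dist_uMk U M _ _) fun i => (M i).dist_le _ _ _
  func f a := uMk U fun i => (M i).func f fun k => uRep (a k) i
  func_unif f ε hε a b h := by
    refine le_of_tendsto (tendsto_dist_uMk U M _ _) ?_
    have h' := eventually_dist_lt U M (fun k => uRep (a k)) (fun k => uRep (b k))
      (L.fmod_pos f ε hε) (by simpa only [uMk_uRep] using h)
    filter_upwards [h'] with i hi
    exact (M i).func_unif f ε hε _ _ hi
  rel R a := uLim U fun i => (M i).rel R fun k => uRep (a k) i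
  rel_mem R a := isClosed_Icc.mem_of_tendsto (tendsto_rel U M R _)
    (Eventually.of_forall fun i => (M i).rel_mem R _)
  rel_unif R ε hε a b h := by
    refine le_of_tendsto ((tendsto_rel U M R _).dist (tendsto_rel U M R _)) ?_
    have h' := eventually_dist_lt U M (fun k => uRep (a k)) (fun k => uRep (b k))
      (L.rmod_pos R ε hε) (by simpa only [uMk_uRep] using h)
    filter_upwards [h'] with i hi
    exact (M i).rel_unif R ε hε _ _ hi

variable {M} in
/-- The tuple `(a_i)^•` of the ultraproduct given by a family of tuples. -/
def uPt {α : Type} {s : α → L.Sorts} (a : (i : I) → (M i).Pt s) : (ultraproduct U M).Pt s :=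
  fun k => uMk U fun i => a i k

theorem ultraproduct_func (f : L.Funcs) (x : (i : I) → (M i).Pt (L.fdom f)) :
    (ultraproduct U M).func f (uPt U x) = uMk U fun i => (M i).func f (x i) := by
  refine dist_le_zero.mp (le_of_forall_pos_le_add fun ε hε => ?_)
  rw [zero_add]
  refine le_of_tendsto (tendsto_dist_uMk U M _ _) ?_
  have h' := eventually_dist_lt_of_eq U M (fun k => uRep (uPt U x k)) (fun k i => x i k)
    (L.fmod_pos f ε hε) fun k => uMk_uRep U M (uPt U x k)
  filter_upwards [h'] with i hi
  exact (M i).func_unif f ε hε _ _ hi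

theorem ultraproduct_rel (R : L.Rels) (x : (i : I) → (M i).Pt (L.rdom R)) :
    Tendsto (fun i => (M i).rel R (x i)) U (𝓝 ((ultraproduct U M).rel R (uPt U x))) := by
  have h1 := tendsto_rel U M R fun k i => x i k
  have h2 := tendsto_rel U M R fun k => uRep (uPt U x k)
  have h : (ultraproduct U M).rel R (uPt U x) = uLim U fun i => (M i).rel R (x i) := by
    refine dist_le_zero.mp (le_of_forall_pos_le_add fun ε hε => ?_)
    rw [zero_add]
    refine le_of_tendsto (h2.dist h1) ?_
    have h' := eventually_dist_lt_of_eq U M (fun k => uRep (uPt U x k)) (fun k i => x i k)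
      (L.rmod_pos R ε hε) fun k => uMk_uRep U M (uPt U x k)
    filter_upwards [h'] with i hi
    exact (M i).rel_unif R ε hε _ _ hi
  rw [h]
  exact h1

theorem uEnv_cons {Γ : List L.Sorts} {S : L.Sorts} (a : (i : I) → (M i).carrier S)
    (e : (i : I) → (M i).Env Γ) :
    (fun j => uMk U fun i => (Struc.Env.cons (a i) (e i) : (M i).Env (S :: Γ)) j) =
      (Struc.Env.cons (M := ultraproduct U M) (uMk U a) (fun j => uMk U fun i => e i j) :
        (ultraproduct U M).Env (S :: Γ)) := by
  funext j
  refine Fin.cases ?_ (fun j => ?_) j <;> rfl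

theorem ultraproduct_term {α : Type} {s : α → L.Sorts} {Γ : List L.Sorts} {S : L.Sorts}
    (t : Term L s Γ S) (v : (i : I) → (M i).Pt s) (e : (i : I) → (M i).Env Γ) :
    t.eval (ultraproduct U M) (uPt U v) (fun j => uMk U fun i => e i j) =
      uMk U fun i => t.eval (M i) (v i) (e i) := by
  induction t with
  | var i => rfl
  | bvar j => rfl
  | func f ts ih =>
    simp only [Term.eval, ih]
    exact ultraproduct_func U M f fun i k => (ts k).eval (M i) (v i) (e i)

/-- The theorem of Łoś; it is what makes an ultraproduct of models of `T` a model of `T`. -/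
theorem ultraproduct_formula {α : Type} {s : α → L.Sorts} {Γ : List L.Sorts}
    (φ : BFormula L s Γ) (v : (i : I) → (M i).Pt s) (e : (i : I) → (M i).Env Γ) :
    Tendsto (fun i => φ.eval (M i) (v i) (e i)) U
      (𝓝 (φ.eval (ultraproduct U M) (uPt U v) fun j => uMk U fun i => e i j)) := by
  induction φ with
  | rel R ts =>
    simp only [BFormula.eval, ultraproduct_term]
    exact ultraproduct_rel U M R fun i k => (ts k).eval (M i) (v i) (e i)
  | dist t₁ t₂ =>
    simp only [BFormula.eval, ultraproduct_term]
    exact tendsto_dist_uMk U M _ _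
  | conn g φ ih =>
    simp only [BFormula.eval]
    exact (g.continuous.tendsto _).comp (tendsto_pi_nhds.mpr fun k => ih k e)
  | sup S φ ih =>
    obtain ⟨B, hB⟩ := φ.exists_bound
    obtain ⟨B', hB'⟩ := (BFormula.sup S φ).exists_bound
    have hb : ∀ (N : Struc L) (w : N.Pt s) (f : N.Env _),
        BddAbove (range fun a => φ.eval N w (Struc.Env.cons a f)) := fun N w f =>
      ⟨B, by rintro _ ⟨a, rfl⟩; exact (abs_le.mp (hB N w _)).2⟩
    have hT := tendsto_uLim U fun i => hB' (M i) (v i) (e i)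
    convert hT using 2
    have key := fun a => uEnv_cons U M (S := S) a e
    apply le_antisymm
    · simp only [BFormula.eval]
      have : Nonempty ((ultraproduct U M).carrier S) := (ultraproduct U M).nonempty S
      refine ciSup_le fun q => ?_
      obtain ⟨z, rfl⟩ : ∃ z, uMk U z = q := ⟨_, uMk_uRep U M q⟩
      have h1 := ih fun i => Struc.Env.cons (z i) (e i)
      rw [key] at h1
      exact le_of_tendsto_of_tendsto' h1 hT fun i => le_ciSup (hb (M i) (v i) (e i)) _
    · refine le_of_forall_pos_le_add fun ε hε => ?_
      have hex : ∀ i, ∃ a, (BFormula.sup S φ).eval (M i) (v i) (e i) - ε <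
          φ.eval (M i) (v i) (Struc.Env.cons a (e i)) := fun i =>
        exists_lt_of_lt_ciSup (by simp only [BFormula.eval]; linarith)
      choose a ha using hex
      have h1 := ih fun i => Struc.Env.cons (a i) (e i)
      rw [key] at h1
      have h2 := le_of_tendsto_of_tendsto' (hT.sub_const ε) h1 fun i => (ha i).le
      have h3 := le_ciSup (hb (ultraproduct U M) (uPt U v) fun j => uMk U fun i => e i j) (uMk U a)
      simp only [BFormula.eval] at h2 ⊢
      linarith
  | inf S φ ih =>
    obtain ⟨B, hB⟩ := φ.exists_bound
    obtain ⟨B', hB'⟩ := (BFormula.inf S φ).exists_bound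
    have hb : ∀ (N : Struc L) (w : N.Pt s) (f : N.Env _),
        BddBelow (range fun a => φ.eval N w (Struc.Env.cons a f)) := fun N w f =>
      ⟨-B, by rintro _ ⟨a, rfl⟩; exact (abs_le.mp (hB N w _)).1⟩
    have hT := tendsto_uLim U fun i => hB' (M i) (v i) (e i)
    convert hT using 2
    have key := fun a => uEnv_cons U M (S := S) a e
    apply le_antisymm
    · refine le_of_forall_pos_le_add fun ε hε => ?_
      have hex : ∀ i, ∃ a, φ.eval (M i) (v i) (Struc.Env.cons a (e i)) <
          (BFormula.inf S φ).eval (M i) (v i) (e i) + ε := fun i =>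
        exists_lt_of_ciInf_lt (by simp only [BFormula.eval]; linarith)
      choose a ha using hex
      have h1 := ih fun i => Struc.Env.cons (a i) (e i)
      rw [key] at h1
      have h2 := le_of_tendsto_of_tendsto' h1 (hT.add_const ε) fun i => (ha i).le
      have h3 := ciInf_le (hb (ultraproduct U M) (uPt U v) fun j => uMk U fun i => e i j) (uMk U a)
      simp only [BFormula.eval] at h2 ⊢
      linarith
    · simp only [BFormula.eval]
      have : Nonempty ((ultraproduct U M).carrier S) := (ultraproduct U M).nonempty S
      refine le_ciInf fun q => ?_
      obtain ⟨z, rfl⟩ : ∃ z, uMk U z = q := ⟨_, uMk_uRep U M q⟩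
      have h1 := ih fun i => Struc.Env.cons (z i) (e i)
      rw [key] at h1
      exact le_of_tendsto_of_tendsto' hT h1 fun i => ciInf_le (hb (M i) (v i) (e i)) _

theorem tendsto_interp {α : Type} {s : α → L.Sorts} (φ : Formula L s) (a : (i : I) → (M i).Pt s) :
    Tendsto (fun i => φ.interp (M i) (a i)) U (𝓝 (φ.interp (ultraproduct U M) (uPt U a))) := by
  have h := ultraproduct_formula U M φ a fun i => Struc.Env.nil (M i)
  have e : (fun j => uMk U fun i => Struc.Env.nil (M i) j) = Struc.Env.nil (ultraproduct U M) := by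
    funext j
    exact j.elim0
  rw [e] at h
  exact h

/-- The ultraproduct of a family of models of `T`, as a model of `T`. -/
def Model.ultraproduct {T : Theory L} (U : Ultrafilter I) (M : I → Model T) : Model T where
  str := ContLogic.ultraproduct U fun i => (M i).str
  models σ hσ := by
    have h := tendsto_interp U (fun i => (M i).str) σ fun i k => k.elim
    have e : uPt U (fun i (k : Empty) => (k.elim : (M i).str.carrier (Empty.elim k))) =
        fun k => k.elim := by
      funext k
      exact k.elim
    rw [e] at h
    refine tendsto_nhds_unique h ?_
    simp only [(M _).models σ hσ]
    exact tendsto_const_nhds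

end Ultraproduct

/-! ### `T`-formulae -/

/-- The `L`-formulae over `s`, to be equipped with the pseudometric given by `T`. -/
def SimpleFormula (_T : Theory L) {α : Type} (s : α → L.Sorts) : Type u := Formula L s

section TFormula

variable {T : Theory L} {α : Type} {s : α → L.Sorts}

/-- The values of `|φ - ψ|` in models of `T`. -/
def diffSet (φ ψ : SimpleFormula T s) : Set ℝ :=
  {r | ∃ (M : Model T) (a : M.str.Pt s),
    r = |Formula.interp M.str φ a - Formula.interp M.str ψ a|}

theorem bddAbove_diffSet (φ ψ : SimpleFormula T s) : BddAbove (diffSet φ ψ) := by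
  obtain ⟨B, hB⟩ := BFormula.exists_bound φ
  obtain ⟨C, hC⟩ := BFormula.exists_bound ψ
  refine ⟨B + C, ?_⟩
  rintro _ ⟨M, a, rfl⟩
  exact (abs_sub _ _).trans (add_le_add (hB M.str a _) (hC M.str a _))

/-- `d(φ, ψ) = sup |φ^M(a) - ψ^M(a)|`, over all models `M` of `T` and all tuples `a`. -/
instance : Dist (SimpleFormula T s) := ⟨fun φ ψ => sSup (diffSet φ ψ)⟩

theorem SimpleFormula.abs_sub_le (φ ψ : SimpleFormula T s) (M : Model T) (a : M.str.Pt s) :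
    |Formula.interp M.str φ a - Formula.interp M.str ψ a| ≤ dist φ ψ :=
  le_csSup (bddAbove_diffSet φ ψ) ⟨M, a, rfl⟩

theorem SimpleFormula.dist_le {φ ψ : SimpleFormula T s} {r : ℝ} (hr : 0 ≤ r)
    (h : ∀ (M : Model T) (a : M.str.Pt s),
      |Formula.interp M.str φ a - Formula.interp M.str ψ a| ≤ r) : dist φ ψ ≤ r :=
  Real.sSup_le (by rintro _ ⟨M, a, rfl⟩; exact h M a) hr

theorem SimpleFormula.dist_nonneg' (φ ψ : SimpleFormula T s) : 0 ≤ dist φ ψ :=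
  Real.sSup_nonneg (by rintro _ ⟨M, a, rfl⟩; exact abs_nonneg _)

instance : PseudoMetricSpace (SimpleFormula T s) where
  dist_self φ := le_antisymm (SimpleFormula.dist_le le_rfl fun M a => by simp)
    (SimpleFormula.dist_nonneg' φ φ)
  dist_comm φ ψ := le_antisymm
    (SimpleFormula.dist_le (SimpleFormula.dist_nonneg' ψ φ) fun M a => by
      rw [abs_sub_comm]; exact SimpleFormula.abs_sub_le ψ φ M a)
    (SimpleFormula.dist_le (SimpleFormula.dist_nonneg' φ ψ) fun M a => by
      rw [abs_sub_comm]; exact SimpleFormula.abs_sub_le φ ψ M a)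
  dist_triangle φ ψ χ := SimpleFormula.dist_le
    (add_nonneg (SimpleFormula.dist_nonneg' φ ψ) (SimpleFormula.dist_nonneg' ψ χ)) fun M a =>
    (abs_sub_le _ _ _).trans
      (add_le_add (SimpleFormula.abs_sub_le φ ψ M a) (SimpleFormula.abs_sub_le ψ χ M a))

end TFormula

/-- `T`-formulae over `s`: the completion of the pseudometric space of `L`-formulae. -/
abbrev TFormula (T : Theory L) {α : Type} (s : α → L.Sorts) : Type u :=
  UniformSpace.Completion (SimpleFormula T s)

/-- Real-valued functions on the pairs `(M, a)` with `M ⊨ T` and `a ∈ M^x`. Boundedness is not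
recorded: it is automatic for interpretations of `T`-formulae, for functions realized by them, and
for the suprema, infima and distances below. -/
abbrev TFunction (T : Theory L) {α : Type} (s : α → L.Sorts) : Type (u + 1) :=
  (M : Model T) → M.str.Pt s → ℝ

section Definability

variable {T : Theory L} {α β : Type} {s : α → L.Sorts} {t : β → L.Sorts}

/-- The interpretation of a `T`-formula: the continuous extension of `φ ↦ φ^M(a)` to the
completion. -/
def TFormula.interp (φ : TFormula T s) : TFunction T s := fun M a =>
  UniformSpace.Completion.extension
    (fun ψ : SimpleFormula T s => Formula.interp M.str ψ a) φ

theorem SimpleFormula.uniformContinuous_interp (M : Model T) (a : M.str.Pt s) :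
    UniformContinuous fun ψ : SimpleFormula T s => Formula.interp M.str ψ a :=
  (LipschitzWith.of_dist_le_mul (K := 1) fun φ ψ => by
    rw [Real.dist_eq, NNReal.coe_one, one_mul]
    exact SimpleFormula.abs_sub_le φ ψ M a).uniformContinuous

theorem TFormula.interp_coe (ψ : SimpleFormula T s) (M : Model T) (a : M.str.Pt s) :
    TFormula.interp (ψ : TFormula T s) M a = Formula.interp M.str ψ a :=
  UniformSpace.Completion.extension_coe (SimpleFormula.uniformContinuous_interp M a) ψ

/-- `Φ` is realized by a `T`-formula. -/
def TFunction.Realized (Φ : TFunction T s) : Prop :=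
  ∃ φ : TFormula T s, ∀ (M : Model T) (a : M.str.Pt s), φ.interp M a = Φ M a

def TFunction.Nonneg (Φ : TFunction T s) : Prop :=
  ∀ (M : Model T) (a : M.str.Pt s), 0 ≤ Φ M a

/-- Almost-near `T`-functions (these are nonnegative by definition). -/
def TFunction.AlmostNear [Fintype α] (Φ : TFunction T s) : Prop :=
  Φ.Nonneg ∧ ∀ ε : ℝ, 0 < ε → ∃ δ : ℝ, 0 < δ ∧ ∀ (M : Model T) (a : M.str.Pt s), Φ M a < δ →
    ∃ b : M.str.Pt s, dist a b ≤ ε ∧ Φ M b = 0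

variable (T s) in
/-- `T`-functors: closed subsets `X(M)` of `M^x` such that every elementary embedding of models
restricts to a map `X(M) → X(N)`. -/
structure TFunctor where
  obj : (M : Model T) → Set (M.str.Pt s)
  isClosed : ∀ M, IsClosed (obj M)
  map_mem : ∀ (M N : Model T) (f : ElemEmb M.str N.str) (a : M.str.Pt s), a ∈ obj M →
    (fun i => f.toFun (s i) (a i)) ∈ obj N

/-- `X = Z(φ)`. -/
def TFunctor.IsZerosetOf (X : TFunctor T s) (φ : TFormula T s) : Prop :=
  ∀ M : Model T, X.obj M = {a | φ.interp M a = 0}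

open Classical in
/-- The function `(M, b) ↦ sup_{a ∈ X(M)} Φ(M, a, b)`, with value `c` where `X(M)` is empty. -/
def TFunctor.supOver (X : TFunctor T s) (c : ℝ) (Φ : TFunction T (Sum.elim s t)) :
    TFunction T t := fun M b =>
  if (X.obj M).Nonempty then sSup ((fun a : M.str.Pt s => Φ M (a.append b)) '' X.obj M) else c

open Classical in
/-- The function `(M, b) ↦ inf_{a ∈ X(M)} Φ(M, a, b)`, with value `c` where `X(M)` is empty. -/
def TFunctor.infOver (X : TFunctor T s) (c : ℝ) (Φ : TFunction T (Sum.elim s t)) :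
    TFunction T t := fun M b =>
  if (X.obj M).Nonempty then sInf ((fun a : M.str.Pt s => Φ M (a.append b)) '' X.obj M) else c

open Classical in
/-- The function `(M, b) ↦ d(b, X(M)) = inf_{a ∈ X(M)} d(a, b)`, with value `c` where `X(M)` is
empty. -/
def TFunctor.distTo [Fintype α] (X : TFunctor T s) (c : ℝ) : TFunction T s := fun M b =>
  if (X.obj M).Nonempty then sInf ((fun a : M.str.Pt s => dist a b) '' X.obj M) else c

/-- The ultraproduct of the sets `X(M_i)`, as a subset of the ultraproduct of the `M_i`: the classes
of families that lie in `X(M_i)` for `U`-almost all `i`. -/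
def TFunctor.ultraprod (X : TFunctor T s) {I : Type u} (U : Ultrafilter I) (M : I → Model T) :
    Set ((Model.ultraproduct U M).str.Pt s) :=
  {q | ∃ a : (i : I) → (M i).str.Pt s, (∀ᶠ i in (U : Filter I), a i ∈ X.obj (M i)) ∧
    q = uPt U (M := fun i => (M i).str) a}

end Definability

end ContLogic

end

/-! Everything rests on ultraproducts. The space of complete types of `T` is compact, because an
ultraproduct of realizations realizes the limit of their types, and by Stone–Weierstrass the
formulae are uniformly dense among the continuous functions on it. Hence a function of pairs `(M,
a)` is realized as soon as it depends only on the type of `a` and passes to limits along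
ultraproducts (`TFunction.realized_of_tendsto`).

Condition 4 is the hub. If `X` commutes with ultraproducts, choosing near-optimal points in each
factor shows that suprema over `X` pass to ultraproducts (`tendsto_supOver`). They also depend only
on the type: when `b` in `M` and `b'` in `N` have the same type, `N` embeds elementarily into an
ultrapower of `M` with `b'` going to the diagonal image of `b` (`exists_elemEmb_ultrapower`).
Functoriality of `X` carries `X(N)` into `X` of the ultrapower, over which the supremum is the same
as over `X(M)`. This gives condition 1. The distance to `X` is a special infimum, and when realized
it is an almost-near formula whose zeroset is `X`, as `X` is closed.

Conversely, almost-nearness replaces approximate zeros in the factors by nearby true zeros, which is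
what commuting with ultraproducts asks for (`commutesUltraprod_of_almostNear`). If 4 holds and a
nonnegative formula defining `X` were not almost-near, an ultraproduct of counterexamples would
contain a zero not represented by zeros (`CommutesUltraprod.almostNear`). Replacing a formula by its
absolute value closes the circle from 5 to 3.

Empty values of `X` do no harm: emptiness itself is decided by almost all factors, and the positive
default distance separates it from small distances. -/

namespace ContLogic

variable {L : Signature.{u}}

/-! ### Substitution and quantification over finite tuples -/

section Substitution

variable {α β : Type} {s : α → L.Sorts} {t : β → L.Sorts}

/-- Weakening by a new innermost bound variable. -/
def Term.weaken {Γ : List L.Sorts} (S' : L.Sorts) :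
    {S : L.Sorts} → Term L s Γ S → Term L s (S' :: Γ) S
  | _, .var i => .var i
  | _, .bvar j => .bvar (Γ := S' :: Γ) j.succ
  | _, .func f ts => .func f fun i => (ts i).weaken S'

theorem Term.eval_weaken (M : Struc L) {Γ : List L.Sorts} {S S' : L.Sorts} (τ : Term L s Γ S)
    (v : M.Pt s) (e : M.Env Γ) (a : M.carrier S') :
    (τ.weaken S').eval M v (Struc.Env.cons a e) = τ.eval M v e := by
  induction τ with
  | var i => rfl
  | bvar j => rfl
  | func f ts ih => simp only [Term.weaken, Term.eval, ih]

/-- Simultaneous substitution of terms for free and bound variables. -/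
def Term.subst {Γ Δ : List L.Sorts} (σ : (i : α) → Term L t Δ (s i))
    (ρ : (j : Fin Γ.length) → Term L t Δ (Γ.get j)) :
    {S : L.Sorts} → Term L s Γ S → Term L t Δ S
  | _, .var i => σ i
  | _, .bvar j => ρ j
  | _, .func f ts => .func f fun i => (ts i).subst σ ρ

theorem Term.eval_subst (M : Struc L) {Γ Δ : List L.Sorts} {S : L.Sorts}
    (σ : (i : α) → Term L t Δ (s i)) (ρ : (j : Fin Γ.length) → Term L t Δ (Γ.get j))
    (τ : Term L s Γ S) (v : M.Pt t) (e : M.Env Δ) :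
    (τ.subst σ ρ).eval M v e =
      τ.eval M (fun i => (σ i).eval M v e) (fun j => (ρ j).eval M v e) := by
  induction τ with
  | var i => rfl
  | bvar j => rfl
  | func f ts ih => simp only [Term.subst, Term.eval, ih]

/-- The substitution for bound variables, lifted under a quantifier. -/
def liftBound {Γ Δ : List L.Sorts} (S : L.Sorts)
    (ρ : (j : Fin Γ.length) → Term L t Δ (Γ.get j)) :
    (j : Fin (S :: Γ).length) → Term L t (S :: Δ) ((S :: Γ).get j) :=
  Fin.cons (α := fun j : Fin (Γ.length + 1) => Term L t (S :: Δ) ((S :: Γ).get j))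
    (.bvar (Γ := S :: Δ) (0 : Fin (Δ.length + 1))) fun j => (ρ j).weaken S

theorem eval_liftBound (M : Struc L) {Γ Δ : List L.Sorts} {S : L.Sorts}
    (ρ : (j : Fin Γ.length) → Term L t Δ (Γ.get j)) (v : M.Pt t) (e : M.Env Δ)
    (a : M.carrier S) :
    (fun j => (liftBound S ρ j).eval M v (Struc.Env.cons a e)) =
      (Struc.Env.cons a (fun j => (ρ j).eval M v e) : M.Env (S :: Γ)) := by
  funext j
  refine Fin.cases ?_ (fun j => ?_) j
  · rfl
  · exact Term.eval_weaken M (ρ j) v e a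

/-- Simultaneous substitution of terms for free and bound variables in a formula. -/
def BFormula.subst : {Γ Δ : List L.Sorts} → BFormula L s Γ →
    (σ : (i : α) → Term L t Δ (s i)) →
    (ρ : (j : Fin Γ.length) → Term L t Δ (Γ.get j)) → BFormula L t Δ
  | _, _, .rel R ts, σ, ρ => .rel R fun i => (ts i).subst σ ρ
  | _, _, .dist t₁ t₂, σ, ρ => .dist (t₁.subst σ ρ) (t₂.subst σ ρ)
  | _, _, .conn g φ, σ, ρ => .conn g fun i => (φ i).subst σ ρ
  | _, _, .sup S φ, σ, ρ => .sup S (φ.subst (fun i => (σ i).weaken S) (liftBound S ρ))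
  | _, _, .inf S φ, σ, ρ => .inf S (φ.subst (fun i => (σ i).weaken S) (liftBound S ρ))

/-- The substitutions are quantified after `φ` because passing under a quantifier replaces them by
their weakened and lifted versions. -/
theorem BFormula.eval_subst (M : Struc L) {Γ : List L.Sorts} (φ : BFormula L s Γ) :
    ∀ {Δ : List L.Sorts} (σ : (i : α) → Term L t Δ (s i))
      (ρ : (j : Fin Γ.length) → Term L t Δ (Γ.get j)) (v : M.Pt t) (e : M.Env Δ),
      (φ.subst σ ρ).eval M v e =
        φ.eval M (fun i => (σ i).eval M v e) (fun j => (ρ j).eval M v e) := by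
  induction φ with
  | rel R ts => intros; simp only [BFormula.subst, BFormula.eval, Term.eval_subst]
  | dist t₁ t₂ => intros; simp only [BFormula.subst, BFormula.eval, Term.eval_subst]
  | conn g φ ih => intros; simp only [BFormula.subst, BFormula.eval, ih]
  | sup S φ ih =>
    intros
    simp only [BFormula.subst, BFormula.eval, ih, Term.eval_weaken, eval_liftBound]
  | inf S φ ih =>
    intros
    simp only [BFormula.subst, BFormula.eval, ih, Term.eval_weaken, eval_liftBound]

/-- Substitution of terms for the free variables of a formula. -/
def Formula.subst {Δ : List L.Sorts} (φ : Formula L s) (σ : (i : α) → Term L t Δ (s i)) :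
    BFormula L t Δ :=
  BFormula.subst φ σ fun j => j.elim0

theorem Formula.eval_subst (M : Struc L) {Δ : List L.Sorts} (φ : Formula L s)
    (σ : (i : α) → Term L t Δ (s i)) (v : M.Pt t) (e : M.Env Δ) :
    (φ.subst σ).eval M v e = φ.interp M fun i => (σ i).eval M v e := by
  have h : (fun j : Fin ([] : List L.Sorts).length =>
      Term.eval M v e (Fin.elim0 j : Term L t Δ (([] : List L.Sorts).get j))) =
      Struc.Env.nil M := by
    funext j
    exact j.elim0
  rw [Formula.subst, BFormula.eval_subst, h]
  rfl

/-- The infimum of a formula over a finite tuple of its variables is given by a formula. -/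
theorem Formula.exists_inf {m : ℕ} (t : Fin m → L.Sorts) (φ : Formula L (Sum.elim s t)) :
    ∃ ψ : Formula L s, ∀ (M : Struc L) (a : M.Pt s),
      (∀ b : M.Pt t, ψ.interp M a ≤ φ.interp M (a.append b)) ∧
      ∀ ε > 0, ∃ b : M.Pt t, φ.interp M (a.append b) < ψ.interp M a + ε := by
  induction m with
  | zero =>
    refine ⟨φ.subst (Sum.rec (fun i => .var i) fun j => j.elim0), fun M a => ?_⟩
    have h : ∀ b : M.Pt t, Formula.interp M (φ.subst (t := s) (Δ := [])
        (Sum.rec (fun i => .var i) fun j => j.elim0)) a = φ.interp M (a.append b) := by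
      intro b
      rw [Formula.interp, Formula.eval_subst]
      congr 1
      funext i
      rcases i with i | j
      · rfl
      · exact j.elim0
    exact ⟨fun b => (h b).le, fun ε hε => ⟨fun j => j.elim0, by rw [← h]; linarith⟩⟩
  | succ m ih =>
    -- The first variable of the tuple becomes the bound variable of the new innermost `inf`; the
    -- other `m` stay free and are left to the induction hypothesis.
    let σ : (i : α ⊕ Fin (m + 1)) →
        Term L (Sum.elim s fun j : Fin m => t j.succ) [t 0] (Sum.elim s t i) :=
      Sum.rec (fun i => .var (s := Sum.elim s fun j : Fin m => t j.succ) (Sum.inl i))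
        (Fin.cases (.bvar (Γ := [t 0]) (0 : Fin 1))
          fun j => .var (s := Sum.elim s fun j : Fin m => t j.succ) (Sum.inr j))
    obtain ⟨ψ, hψ⟩ := ih (fun j => t j.succ) (BFormula.inf (t 0) (φ.subst σ))
    refine ⟨ψ, fun M a => ?_⟩
    have key : ∀ (b : M.Pt fun j => t (Fin.succ j)) (c : M.carrier (t 0)),
        (φ.subst σ).eval M (a.append b) (Struc.Env.cons c (Struc.Env.nil M)) =
          φ.interp M (a.append (Fin.cons (α := fun j => M.carrier (t j)) c b)) := by
      intro b c
      rw [Formula.eval_subst]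
      congr 1
      funext i
      rcases i with i | j
      · rfl
      · refine Fin.cases ?_ (fun j => ?_) j <;> rfl
    have hinf : ∀ b : M.Pt fun j => t (Fin.succ j),
        Formula.interp M (BFormula.inf (t 0) (φ.subst σ)) (a.append b) =
          ⨅ c, φ.interp M (a.append (Fin.cons (α := fun j => M.carrier (t j)) c b)) := by
      intro b
      simp only [Formula.interp, BFormula.eval]
      exact iInf_congr fun c => key b c
    obtain ⟨B, hB⟩ := BFormula.exists_bound φ
    constructor
    · intro b
      refine ((hψ M a).1 fun j => b j.succ).trans ?_
      rw [hinf]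
      refine (ciInf_le ⟨-B, ?_⟩ (b 0)).trans_eq ?_
      · rintro _ ⟨c, rfl⟩
        exact (abs_le.mp (hB M _ _)).1
      · rw [show Fin.cons (α := fun j => M.carrier (t j)) (b 0) (fun j => b j.succ) = b from
          Fin.cons_self_tail b]
    · intro ε hε
      obtain ⟨b, hb⟩ := (hψ M a).2 ε hε
      rw [hinf] at hb
      obtain ⟨c, hc⟩ := exists_lt_of_ciInf_lt hb
      exact ⟨_, hc⟩

end Substitution

/-! ### Elementary maps into ultrapowers -/

section Ultrapower

variable {n : ℕ} {s : Fin n → L.Sorts}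

/-- A function on finitely many elements of a family extends to the whole family. -/
theorem exists_extend_of_injective {ι : Type*} {A B : ι → Type*} [∀ i, Nonempty (B i)] {k : Type*}
    {e : k → Σ i, A i} (he : Function.Injective e) (d : (j : k) → B (e j).1) :
    ∃ f : (i : ι) → A i → B i, ∀ j, f (e j).1 (e j).2 = d j := by
  have h : ∀ p : Σ i, A i, ∃ y : B p.1, ∀ j (hj : e j = p), y = hj ▸ d j := by
    intro p
    by_cases hp : ∃ j, e j = p
    · obtain ⟨j, rfl⟩ := hp
      refine ⟨d j, fun j' hj' => ?_⟩
      -- Injectivity makes the prescribed values consistent: two indices over the same point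
      -- coincide.
      obtain rfl := he hj'
      rfl
    · exact ⟨Classical.arbitrary _, fun j hj => (hp ⟨j, hj⟩).elim⟩
  choose g hg using h
  exact ⟨fun i x => g ⟨i, x⟩, fun j => hg (e j) j rfl⟩

/-- A formula with finitely many parameters from `N`. -/
structure ParamFormula (N : Struc L) (s : Fin n → L.Sorts) where
  arity : ℕ
  sorts : Fin arity → L.Sorts
  params : N.Pt sorts
  formula : Formula L (Sum.elim s sorts)

/-- The value of a formula with parameters from `N` after mapping the parameters to `M`. -/
noncomputable def ParamFormula.eval {N : Struc L} (c : ParamFormula N s) (M : Struc L) (a : M.Pt s)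
    (f : (S : L.Sorts) → N.carrier S → M.carrier S) : ℝ :=
  c.formula.interp M (a.append fun j => f _ (c.params j))

/-- Brings several formulae with parameters to one common list `e` of parameters. If `e` has no
repetitions, any choice of values for its entries comes from a map on `N`. -/
theorem ParamFormula.exists_formula {N : Struc L} (c : ParamFormula N s) {m : ℕ}
    (e : Fin m → Σ S, N.carrier S) (h : ∀ j, ⟨c.sorts j, c.params j⟩ ∈ range e) :
    ∃ φ : Formula L (Sum.elim s fun k => (e k).1), ∀ (M : Struc L) (a : M.Pt s)
      (f : (S : L.Sorts) → N.carrier S → M.carrier S),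
      φ.interp M (a.append fun k => f _ (e k).2) = c.eval M a f := by
  -- Stated for an arbitrary `q` in the range, so that destructing membership identifies the sorts
  -- without a cast.
  have hτ : ∀ q : Σ S, N.carrier S, q ∈ range e →
      ∃ τ : Term L (Sum.elim s fun k => (e k).1) [] q.1, ∀ (M : Struc L) (a : M.Pt s)
        (f : (S : L.Sorts) → N.carrier S → M.carrier S),
        τ.eval M (a.append fun k => f _ (e k).2) (Struc.Env.nil M) = f q.1 q.2 := by
    rintro _ ⟨k, rfl⟩
    exact ⟨.var (s := Sum.elim s fun k => (e k).1) (Sum.inr k), fun M a f => rfl⟩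
  choose τ hτ using fun j => hτ _ (h j)
  refine ⟨c.formula.subst (Sum.rec
    (fun i => .var (s := Sum.elim s fun k => (e k).1) (Sum.inl i)) τ), fun M a f => ?_⟩
  rw [Formula.interp, Formula.eval_subst, ParamFormula.eval]
  congr 1
  funext i
  rcases i with i | j
  · rfl
  · exact hτ j M a f

/-- Elementarily equivalent tuples: any finitely many values of formulae with parameters are
approximated by moving the parameters. -/
theorem exists_map_approx {M N : Struc L} {a : M.Pt s} {b : N.Pt s}
    (hab : ∀ φ : Formula L s, φ.interp M a = φ.interp N b) (F : Finset (ParamFormula N s))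
    {ε : ℝ} (hε : 0 < ε) :
    ∃ f : (S : L.Sorts) → N.carrier S → M.carrier S, ∀ c ∈ F,
      |c.eval M a f - c.eval N b fun _ => id| < ε := by
  classical
  let E : Finset (Σ S, N.carrier S) :=
    F.biUnion fun c => Finset.univ.image fun j => ⟨c.sorts j, c.params j⟩
  let e : Fin E.card → Σ S, N.carrier S := fun k => E.equivFin.symm k
  have he : Function.Injective e := Subtype.val_injective.comp E.equivFin.symm.injective
  have hr : ∀ c : F, ∀ j, ⟨c.1.sorts j, c.1.params j⟩ ∈ range e := by
    intro c j
    have hmem : (⟨c.1.sorts j, c.1.params j⟩ : Σ S, N.carrier S) ∈ E :=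
      Finset.mem_biUnion.mpr ⟨c.1, c.2, Finset.mem_image_of_mem _ (Finset.mem_univ j)⟩
    exact ⟨E.equivFin ⟨_, hmem⟩, by simp [e]⟩
  choose φ hφ using fun c : F => c.1.exists_formula e (hr c)
  let p : Fin F.card → ℝ := fun k => (F.equivFin.symm k).1.eval N b fun _ => id
  -- A single formula measures how far all the values are from their targets. Its infimum over the
  -- parameters is at most `0` at `b`, the original parameters being a witness; by `hab` the same
  -- bound holds at `a`, where some tuple comes within `ε`.
  let g : C(Fin F.card → ℝ, ℝ) := ⟨fun v => ‖v - p‖, by fun_prop⟩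
  let χ : Formula L (Sum.elim s fun k => (e k).1) := .conn g fun k => φ (F.equivFin.symm k)
  have hχ : ∀ (M' : Struc L) v, Formula.interp M' χ v =
      ‖(fun k => (φ (F.equivFin.symm k)).interp M' v) - p‖ := fun M' v => rfl
  obtain ⟨ψ, hψ⟩ := Formula.exists_inf _ χ
  have h0 : ψ.interp N b ≤ 0 := by
    refine ((hψ N b).1 fun k => (e k).2).trans_eq ?_
    rw [hχ, norm_eq_zero, sub_eq_zero]
    funext k
    exact hφ _ N b fun _ => id
  obtain ⟨d, hd⟩ := (hψ M a).2 ε hε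
  obtain ⟨f, hf⟩ := exists_extend_of_injective (B := M.carrier) he d
  obtain rfl : (fun k => f (e k).1 (e k).2) = d := funext hf
  rw [hab, hχ] at hd
  refine ⟨f, fun c hc => ?_⟩
  have h1 := norm_le_pi_norm ((fun k => (φ (F.equivFin.symm k)).interp M
    (a.append fun k => f (e k).1 (e k).2)) - p) (F.equivFin ⟨c, hc⟩)
  simp only [Pi.sub_apply, hφ, p, Equiv.symm_apply_apply, Real.norm_eq_abs] at h1 hd
  linarith

/-- Given elementarily equivalent tuples `a` of `M` and `b` of `N`, there is an elementary embedding
of `N` into an ultrapower of `M` that sends `b` to the class of the constant family `a`. -/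
theorem exists_elemEmb_ultrapower {M N : Struc L} {a : M.Pt s} {b : N.Pt s}
    (hab : ∀ φ : Formula L s, φ.interp M a = φ.interp N b) :
    ∃ (I : Type u) (U : Ultrafilter I) (f : ElemEmb N (ultraproduct U fun _ => M)),
      (fun i => f.toFun (s i) (b i)) = uPt U fun _ => a := by
  -- The index set consists of all sortwise maps `N → M`. An ultrafilter is wanted along which every
  -- formula with parameters converges to its value in `N`; it exists because a basic neighbourhood
  -- of `p` constrains finitely many coordinates, so `exists_map_approx` applies.
  let I : Type u := (S : L.Sorts) → N.carrier S → M.carrier S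
  let Θ : I → ParamFormula N s → ℝ := fun f c => c.eval M a f
  let p : ParamFormula N s → ℝ := fun c => c.eval N b fun _ => id
  have hne : (comap Θ (𝓝 p)).NeBot := by
    rw [comap_neBot_iff]
    intro V hV
    rw [nhds_pi, Filter.mem_pi] at hV
    obtain ⟨F, hF, W, hW, hWV⟩ := hV
    choose δ hδ hδW using fun c => Metric.mem_nhds_iff.mp (hW c)
    obtain ⟨ε, hε, hεδ⟩ : ∃ ε > 0, ∀ c ∈ F, ε ≤ δ c := by
      have h : ∀ᶠ ε in 𝓝[>] (0 : ℝ), ∀ c ∈ F, ε ≤ δ c :=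
        (Filter.eventually_all_finite hF).2 fun c _ =>
          Filter.mem_of_superset (Ioc_mem_nhdsGT (hδ c)) fun ε hε => hε.2
      exact (h.and self_mem_nhdsWithin).exists.imp fun ε hε => ⟨hε.2, hε.1⟩
    obtain ⟨f, hf⟩ := exists_map_approx hab hF.toFinset hε
    refine ⟨f, hWV fun c hc => hδW c ?_⟩
    rw [Metric.mem_ball, Real.dist_eq]
    exact (hf c (hF.mem_toFinset.mpr hc)).trans_le (hεδ c hc)
  let U : Ultrafilter I := Ultrafilter.of (comap Θ (𝓝 p))
  have hU : ∀ c : ParamFormula N s, Tendsto (fun f => c.eval M a f) U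
      (𝓝 (c.eval N b fun _ => id)) :=
    tendsto_pi_nhds.mp ((tendsto_comap (f := Θ) (x := 𝓝 p)).mono_left (Ultrafilter.of_le _))
  -- An element `x` goes to the class of its images under all the maps. Elementarity is Łoś together
  -- with `hU`.
  refine ⟨I, U, ⟨fun S x => uMk U fun f : I => f S x, fun m t φ d => ?_⟩, ?_⟩
  · have h := hU ⟨m, t, d, φ.subst fun j => .var (s := Sum.elim s t) (Sum.inr j)⟩
    have hs : ∀ (M' : Struc L) (v : M'.Pt s) (w : M'.Pt t), Formula.interp M'
        (φ.subst (Δ := []) fun j => .var (s := Sum.elim s t) (Sum.inr j)) (v.append w) =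
          φ.interp M' w := fun M' v w => Formula.eval_subst M' φ _ _ _
    simp only [ParamFormula.eval, hs] at h
    exact tendsto_nhds_unique
      (tendsto_interp U (fun _ => M) φ fun f : I => fun j => f (t j) (d j)) h
  · funext i
    -- The formula is the distance from the `i`th variable to the parameter `b i`; its value in `N`
    -- is `0`.
    have h := hU ⟨1, fun _ => s i, fun _ => b i,
      .dist (.var (s := Sum.elim s fun _ : Fin 1 => s i) (Sum.inl i))
        (.var (s := Sum.elim s fun _ : Fin 1 => s i) (Sum.inr 0))⟩
    have h' : Tendsto (fun f : I => dist (a i) (f (s i) (b i))) U (𝓝 (dist (b i) (b i))) := h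
    rw [dist_self] at h'
    have h2 := tendsto_nhds_unique (tendsto_dist_uMk U (fun _ => M) (fun _ : I => a i)
      fun f : I => f (s i) (b i)) h'
    exact (dist_eq_zero.mp h2).symm

end Ultrapower

/-! ### Interpretations of `T`-formulae -/

section Interp

variable {T : Theory L} {α : Type} {s : α → L.Sorts}

theorem TFormula.continuous_interp (M : Model T) (a : M.str.Pt s) :
    Continuous fun φ : TFormula T s => φ.interp M a :=
  UniformSpace.Completion.continuous_extension

theorem TFormula.abs_interp_sub_le (φ ψ : TFormula T s) (M : Model T) (a : M.str.Pt s) :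
    |φ.interp M a - ψ.interp M a| ≤ dist φ ψ := by
  induction φ, ψ using UniformSpace.Completion.induction_on₂ with
  | hp =>
    have h := TFormula.continuous_interp (s := s) M a
    exact isClosed_le ((h.comp continuous_fst).sub (h.comp continuous_snd)).abs continuous_dist
  | ih φ ψ =>
    rw [TFormula.interp_coe, TFormula.interp_coe, UniformSpace.Completion.dist_eq]
    exact SimpleFormula.abs_sub_le φ ψ M a

/-- `T`-formulae are uniform limits of formulae. -/
theorem TFormula.exists_approx (φ : TFormula T s) {ε : ℝ} (hε : 0 < ε) :
    ∃ ψ : Formula L s, ∀ (M : Model T) (a : M.str.Pt s),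
      |φ.interp M a - ψ.interp M.str a| < ε := by
  obtain ⟨ψ, hψ⟩ := UniformSpace.Completion.denseRange_coe.exists_dist_lt φ hε
  refine ⟨ψ, fun M a => ?_⟩
  rw [← TFormula.interp_coe]
  exact (TFormula.abs_interp_sub_le φ _ M a).trans_lt hψ

theorem TFormula.exists_bound (φ : TFormula T s) :
    ∃ B : ℝ, ∀ (M : Model T) (a : M.str.Pt s), |φ.interp M a| ≤ B := by
  obtain ⟨ψ, hψ⟩ := φ.exists_approx one_pos
  obtain ⟨B, hB⟩ := BFormula.exists_bound ψ
  refine ⟨B + 1, fun M a => ?_⟩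
  have h1 := hψ M a
  have h2 : |ψ.interp M.str a| ≤ B := hB M.str a _
  rw [abs_lt] at h1
  rw [abs_le] at h2 ⊢
  constructor <;> linarith

theorem TFormula.interp_congr (φ : TFormula T s) {M N : Model T} {a : M.str.Pt s} {b : N.str.Pt s}
    (h : ∀ ψ : Formula L s, ψ.interp M.str a = ψ.interp N.str b) :
    φ.interp M a = φ.interp N b := by
  induction φ using UniformSpace.Completion.induction_on with
  | hp => exact isClosed_eq (TFormula.continuous_interp M a) (TFormula.continuous_interp N b)
  | ih ψ => rw [TFormula.interp_coe, TFormula.interp_coe]; exact h ψ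

/-- The theorem of Łoś for `T`-formulae. -/
theorem TFormula.tendsto_interp {I : Type u} (U : Ultrafilter I) (M : I → Model T)
    (φ : TFormula T s) (a : (i : I) → (M i).str.Pt s) :
    Tendsto (fun i => φ.interp (M i) (a i)) U
      (𝓝 (φ.interp (Model.ultraproduct U M) (uPt U a))) := by
  rw [Metric.tendsto_nhds]
  intro ε hε
  obtain ⟨ψ, hψ⟩ := φ.exists_approx (show 0 < ε / 3 by linarith)
  have h := ContLogic.tendsto_interp U (fun i => (M i).str) ψ a
  filter_upwards [Metric.tendsto_nhds.mp h (ε / 3) (by linarith)] with i hi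
  have h1 := abs_lt.mp (hψ (M i) (a i))
  have h2 : |φ.interp (Model.ultraproduct U M) (uPt U a) -
    ψ.interp (ultraproduct U fun i => (M i).str) (uPt U a)| < ε / 3 := hψ _ _
  rw [abs_lt] at h2
  rw [Real.dist_eq, abs_lt] at hi ⊢
  constructor <;> linarith

theorem uPt_append {I : Type u} (U : Ultrafilter I) {M : I → Struc L} {β : Type} {t : β → L.Sorts}
    (a : (i : I) → (M i).Pt s) (b : (i : I) → (M i).Pt t) :
    (uPt U a).append (uPt U b) = uPt U fun i => (a i).append (b i) := by
  funext k
  rcases k with k | k <;> rfl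

/-- Elementary embeddings preserve formulae in any finite set of variables. -/
theorem ElemEmb.map_interp [Fintype α] {M N : Struc L} (f : ElemEmb M N) (φ : Formula L s)
    (a : M.Pt s) : φ.interp N (fun i => f.toFun (s i) (a i)) = φ.interp M a := by
  let e := Fintype.equivFin α
  let t : Fin (Fintype.card α) → L.Sorts := fun k => s (e.symm k)
  -- `ElemEmb` speaks only of variables indexed by `Fin n`. The renaming is given as terms obtained
  -- from surjectivity, which avoids transporting along `e.symm (e i) = i`.
  have hτ : ∀ i, ∃ τ : Term L t [] (s i), ∀ (M : Struc L) (v : M.Pt s),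
      τ.eval M (fun k => v (e.symm k)) (Struc.Env.nil M) = v i := by
    intro i
    obtain ⟨k, rfl⟩ := e.symm.surjective i
    exact ⟨.var (s := t) k, fun M v => rfl⟩
  choose τ hτ using hτ
  have h : ∀ (M : Struc L) (v : M.Pt s),
      Formula.interp M (φ.subst τ) (fun k => v (e.symm k)) = φ.interp M v := by
    intro M v
    rw [Formula.interp, Formula.eval_subst]
    congr 1
    funext i
    exact hτ i M v
  rw [← h, ← h]
  exact f.elementary _ t _ _

theorem TFormula.interp_map [Fintype α] {M N : Model T} (f : ElemEmb M.str N.str)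
    (φ : TFormula T s) (a : M.str.Pt s) :
    φ.interp N (fun i => f.toFun (s i) (a i)) = φ.interp M a :=
  φ.interp_congr fun ψ => f.map_interp ψ a

end Interp

/-! ### The space of types and realizability -/

section TypeSpace

variable (T : Theory L) {α : Type} (s : α → L.Sorts)

/-- The complete types of `T`, as assignments of values to formulae. -/
def typeSpace : Set (Formula L s → ℝ) :=
  {p | ∃ (M : Model T) (a : M.str.Pt s), ∀ φ, p φ = Formula.interp M.str φ a}

/-- Compactness by Łoś: an ultrafilter of types converges to the type of the class of chosen
realizations in their ultraproduct. -/
theorem isCompact_typeSpace : IsCompact (typeSpace T s) := by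
  rw [isCompact_iff_ultrafilter_le_nhds]
  intro U hU
  have hK : typeSpace T s ∈ U := le_principal_iff.mp hU
  obtain ⟨-, M₀, a₀, -⟩ := U.nonempty_of_mem hK
  -- The ultraproduct is indexed by all assignments of values, so assignments that are not types
  -- receive the dummy `M₀`, `a₀`.
  have h : ∀ p : Formula L s → ℝ, ∃ (M : Model T) (a : M.str.Pt s), p ∈ typeSpace T s →
      ∀ φ, p φ = Formula.interp M.str φ a := by
    intro p
    by_cases hp : p ∈ typeSpace T s
    · obtain ⟨M, a, h⟩ := hp
      exact ⟨M, a, fun _ => h⟩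
    · exact ⟨M₀, a₀, fun h => (hp h).elim⟩
  choose M a h using h
  refine ⟨fun φ => φ.interp (ultraproduct U fun p => (M p).str) (uPt U a),
    ⟨Model.ultraproduct U M, uPt U a, fun φ => rfl⟩, ?_⟩
  have hT : Tendsto (fun p : Formula L s → ℝ => p) U
      (𝓝 fun φ => φ.interp (ultraproduct U fun p => (M p).str) (uPt U a)) := by
    refine tendsto_pi_nhds.mpr fun φ => ?_
    refine (tendsto_interp U (fun p => (M p).str) φ a).congr' ?_
    filter_upwards [hK] with p hp
    exact (h p hp φ).symm
  exact hT

variable {T s}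

/-- The type of a tuple. -/
noncomputable def Model.typeOf (M : Model T) (a : M.str.Pt s) : typeSpace T s :=
  ⟨fun φ => Formula.interp M.str φ a, M, a, fun _ => rfl⟩

/-- The value of a formula, as a continuous function on the space of types. -/
def Formula.toTypeFun (φ : Formula L s) : C(typeSpace T s, ℝ) :=
  ⟨fun p => p.1 φ, (continuous_apply φ).comp continuous_subtype_val⟩

theorem typeFun_ext {f g : C(typeSpace T s, ℝ)}
    (h : ∀ (M : Model T) (a : M.str.Pt s), f (M.typeOf a) = g (M.typeOf a)) : f = g := by
  ext ⟨p, M, a, hp⟩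
  obtain rfl : p = fun φ => Formula.interp M.str φ a := funext hp
  exact h M a

variable (T s) in
/-- The algebra of functions on the space of types given by formulae. -/
def formulaSubalgebra : Subalgebra ℝ C(typeSpace T s, ℝ) where
  carrier := range Formula.toTypeFun
  mul_mem' := by
    rintro _ _ ⟨φ, rfl⟩ ⟨ψ, rfl⟩
    exact ⟨.conn (k := 2) ⟨fun v => v 0 * v 1, by fun_prop⟩ ![φ, ψ],
      typeFun_ext fun M a => rfl⟩
  add_mem' := by
    rintro _ _ ⟨φ, rfl⟩ ⟨ψ, rfl⟩
    exact ⟨.conn (k := 2) ⟨fun v => v 0 + v 1, by fun_prop⟩ ![φ, ψ],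
      typeFun_ext fun M a => rfl⟩
  algebraMap_mem' r := ⟨.conn (k := 0) ⟨fun _ => r, by fun_prop⟩ Fin.elim0,
    typeFun_ext fun M a => rfl⟩

/-- Every continuous function on the space of types is realized by a `T`-formula. -/
theorem realized_of_continuousMap (f : C(typeSpace T s, ℝ)) :
    TFunction.Realized fun (M : Model T) (a : M.str.Pt s) => f (M.typeOf a) := by
  have : CompactSpace (typeSpace T s) := isCompact_iff_compactSpace.mp (isCompact_typeSpace T s)
  -- Distinct types differ at some formula, and that formula separates them.
  have hsep : (formulaSubalgebra T s).SeparatesPoints := by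
    intro p q hpq
    obtain ⟨φ, hφ⟩ := Function.ne_iff.mp fun h => hpq (Subtype.ext h)
    exact ⟨_, ⟨_, ⟨φ, rfl⟩, rfl⟩, hφ⟩
  have happrox : ∀ k : ℕ, ∃ ψ : SimpleFormula T s, ∀ (M : Model T) (a : M.str.Pt s),
      |Formula.interp M.str ψ a - f (M.typeOf a)| ≤ 1 / (k + 1 : ℝ) := by
    intro k
    obtain ⟨⟨_, ψ, rfl⟩, hg⟩ :=
      ContinuousMap.exists_mem_subalgebra_near_continuousMap_of_separatesPoints
        (formulaSubalgebra T s) hsep f (1 / (k + 1 : ℝ)) (by positivity)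
    exact ⟨ψ, fun M a => ((ContinuousMap.norm_coe_le_norm _ (M.typeOf a)).trans hg.le)⟩
  choose ψ hψ using happrox
  have hlim : Tendsto (fun k : ℕ => 1 / (k + 1 : ℝ)) atTop (𝓝 0) :=
    tendsto_one_div_add_atTop_nhds_zero_nat
  have hanti : ∀ N k : ℕ, N ≤ k → 1 / (k + 1 : ℝ) ≤ 1 / (N + 1 : ℝ) := fun N k h =>
    one_div_le_one_div_of_le (by positivity) (by exact_mod_cast Nat.succ_le_succ h)
  -- The pseudometric on formulae is the uniform distance over all realized types, so uniform
  -- approximations of `f` are Cauchy in the completion.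
  have hcauchy : CauchySeq fun k => (ψ k : TFormula T s) := by
    refine cauchySeq_of_le_tendsto_0 (fun N : ℕ => 2 * (1 / (N + 1 : ℝ))) (fun k l N hk hl => ?_)
      (by simpa using hlim.const_mul 2)
    rw [UniformSpace.Completion.dist_eq]
    refine SimpleFormula.dist_le (by positivity) fun M a => ?_
    have h1 := abs_le.mp ((hψ k M a).trans (hanti N k hk))
    have h2 := abs_le.mp ((hψ l M a).trans (hanti N l hl))
    rw [abs_le]
    constructor <;> linarith
  obtain ⟨φ, hφ⟩ := cauchySeq_tendsto_of_complete hcauchy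
  refine ⟨φ, fun M a => ?_⟩
  have h1 := ((TFormula.continuous_interp M a).tendsto φ).comp hφ
  refine tendsto_nhds_unique h1 (tendsto_iff_dist_tendsto_zero.mpr
    (squeeze_zero (fun _ => dist_nonneg) (fun k => ?_) hlim))
  rw [Function.comp_apply, TFormula.interp_coe]
  exact hψ k M a

/-- A function that depends only on the type and commutes with ultraproducts is realized. -/
theorem TFunction.realized_of_tendsto {Φ : TFunction T s}
    (hΦ : ∀ (M N : Model T) (a : M.str.Pt s) (b : N.str.Pt s),
      (∀ φ : Formula L s, φ.interp M.str a = φ.interp N.str b) → Φ M a = Φ N b)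
    (hU : ∀ (I : Type u) (U : Ultrafilter I) (M : I → Model T) (a : (i : I) → (M i).str.Pt s),
      Tendsto (fun i => Φ (M i) (a i)) U (𝓝 (Φ (Model.ultraproduct U M) (uPt U a)))) :
    Φ.Realized := by
  have h : ∀ p : typeSpace T s, ∃ (M : Model T) (a : M.str.Pt s),
      ∀ φ, p.1 φ = Formula.interp M.str φ a := fun p => p.2
  choose M a h using h
  let f : C(typeSpace T s, ℝ) := ⟨fun p => Φ (M p) (a p), by
    rw [continuous_iff_ultrafilter]
    intro p U hp
    -- If `U` converges to `p`, the class of the chosen realizations has type `p`, so `Φ` takes the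
    -- same value there as at the realization chosen for `p`.
    have h1 : Φ (Model.ultraproduct U M) (uPt U a) = Φ (M p) (a p) := by
      refine hΦ _ _ _ _ fun φ => ?_
      rw [← h]
      refine tendsto_nhds_unique (tendsto_interp U (fun p => (M p).str) φ a) ?_
      have h2 : Tendsto (fun q : typeSpace T s => q.1 φ) U (𝓝 (p.1 φ)) :=
        (((continuous_apply φ).comp continuous_subtype_val).tendsto p).mono_left hp
      simpa only [h] using h2
    rw [← h1]
    exact hU _ U M a⟩
  obtain ⟨φ, hφ⟩ := realized_of_continuousMap f
  exact ⟨φ, fun N b => (hφ N b).trans (hΦ _ _ _ _ fun φ => (h _ φ).symm)⟩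

/-- `T`-formulae are closed under continuous unary connectives. -/
theorem TFormula.exists_comp (φ : TFormula T s) {g : ℝ → ℝ} (hg : Continuous g) :
    ∃ χ : TFormula T s, ∀ (M : Model T) (a : M.str.Pt s), χ.interp M a = g (φ.interp M a) :=
  TFunction.realized_of_tendsto (fun M N a b h => by rw [φ.interp_congr h])
    fun I U M a => (hg.tendsto _).comp (φ.tendsto_interp U M a)

end TypeSpace

/-! ### Definable sets -/

section Definable

variable {T : Theory L} {n m : ℕ} {x : Fin n → L.Sorts} {y : Fin m → L.Sorts}

/-- The functor commutes with ultraproducts. -/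
def TFunctor.CommutesUltraprod (X : TFunctor T x) : Prop :=
  ∀ (I : Type u) (M : I → Model T) (U : Ultrafilter I),
    X.obj (Model.ultraproduct U M) = X.ultraprod U M

/-- Exhibits the maximum metric as a continuous connective of atomic distances. -/
theorem Struc.dist_eq_norm (M : Struc L) (a b : M.Pt x) :
    dist a b = ‖fun k => dist (a k) (b k)‖ := by
  refine le_antisymm ((dist_pi_le_iff (norm_nonneg _)).2 fun k => ?_)
    ((pi_norm_le_iff_of_nonneg dist_nonneg).2 fun k => ?_)
  · exact (le_abs_self _).trans (norm_le_pi_norm (fun k => dist (a k) (b k)) k)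
  · rw [Real.norm_eq_abs, abs_of_nonneg dist_nonneg]
    exact dist_le_pi_dist a b k

theorem tendsto_dist_uPt {I : Type u} (U : Ultrafilter I) (M : I → Struc L)
    (a b : (i : I) → (M i).Pt x) :
    Tendsto (fun i => dist (a i) (b i)) U (𝓝 (dist (uPt U a) (uPt U b))) := by
  simp only [Struc.dist_eq_norm]
  exact (tendsto_pi_nhds.mpr fun k => tendsto_dist_uMk U M _ _).norm

/-- The distance between two tuples of variables, as a `T`-formula. -/
theorem exists_dist_formula (T : Theory L) (x : Fin n → L.Sorts) :
    ∃ φ : TFormula T (Sum.elim x x), ∀ (M : Model T) (a b : M.str.Pt x),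
      φ.interp M (a.append b) = dist a b := by
  let φ : SimpleFormula T (Sum.elim x x) := .conn ⟨fun v => ‖v‖, continuous_norm⟩ fun k =>
    .dist (.var (s := Sum.elim x x) (Sum.inl k)) (.var (s := Sum.elim x x) (Sum.inr k))
  exact ⟨φ, fun M a b => (TFormula.interp_coe φ M _).trans (M.str.dist_eq_norm a b).symm⟩

variable {X : TFunctor T x}

theorem TFunctor.IsZerosetOf.mem_iff {φ : TFormula T x} (h : X.IsZerosetOf φ) {M : Model T}
    {a : M.str.Pt x} : a ∈ X.obj M ↔ φ.interp M a = 0 := by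
  rw [h]
  rfl

theorem TFunctor.CommutesUltraprod.mem (hX : X.CommutesUltraprod) {I : Type u} {U : Ultrafilter I}
    {M : I → Model T} {a : (i : I) → (M i).str.Pt x} (ha : ∀ᶠ i in (U : Filter I), a i ∈ X.obj (M i)) :
    uPt U a ∈ X.obj (Model.ultraproduct U M) := by
  rw [hX]
  exact ⟨a, ha, rfl⟩

theorem TFunctor.CommutesUltraprod.exists_rep (hX : X.CommutesUltraprod) {I : Type u}
    {U : Ultrafilter I} {M : I → Model T} {q : (Model.ultraproduct U M).str.Pt x}
    (hq : q ∈ X.obj (Model.ultraproduct U M)) :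
    ∃ a : (i : I) → (M i).str.Pt x, (∀ᶠ i in (U : Filter I), a i ∈ X.obj (M i)) ∧
      q = uPt U (M := fun i => (M i).str) a := by
  rwa [hX] at hq

/-- This lets the default value for empty sets pass to ultraproducts. -/
theorem TFunctor.CommutesUltraprod.nonempty_iff (hX : X.CommutesUltraprod) {I : Type u}
    {U : Ultrafilter I} {M : I → Model T} :
    (X.obj (Model.ultraproduct U M)).Nonempty ↔
      ∀ᶠ i in (U : Filter I), (X.obj (M i)).Nonempty := by
  constructor
  · rintro ⟨q, hq⟩
    obtain ⟨a, ha, -⟩ := hX.exists_rep hq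
    exact ha.mono fun i hi => ⟨_, hi⟩
  · intro h
    have : ∀ i, ∃ a : (M i).str.Pt x, (X.obj (M i)).Nonempty → a ∈ X.obj (M i) := by
      intro i
      by_cases hi : (X.obj (M i)).Nonempty
      · exact ⟨hi.some, fun _ => hi.some_mem⟩
      · exact ⟨fun k => Classical.arbitrary _, fun h => (hi h).elim⟩
    choose a ha using this
    exact ⟨_, hX.mem (h.mono fun i hi => ha i hi)⟩

/-! ### Suprema and infima over a functor that commutes with ultraproducts -/

section Sup

variable (X) (c : ℝ) (ψ : TFormula T (Sum.elim x y))

theorem TFunctor.bddAbove_image (M : Model T) (b : M.str.Pt y) :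
    BddAbove ((fun a : M.str.Pt x => ψ.interp M (a.append b)) '' X.obj M) := by
  obtain ⟨B, hB⟩ := ψ.exists_bound
  exact ⟨B, by rintro _ ⟨a, -, rfl⟩; exact (abs_le.mp (hB M _)).2⟩

theorem TFunctor.supOver_of_not_nonempty {M : Model T} (h : ¬ (X.obj M).Nonempty)
    (b : M.str.Pt y) : X.supOver c ψ.interp M b = c :=
  if_neg h

theorem TFunctor.le_supOver {M : Model T} {a : M.str.Pt x} (ha : a ∈ X.obj M) (b : M.str.Pt y) :
    ψ.interp M (a.append b) ≤ X.supOver c ψ.interp M b := by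
  rw [TFunctor.supOver, if_pos ⟨a, ha⟩]
  exact le_csSup (X.bddAbove_image ψ M b) ⟨a, ha, rfl⟩

theorem TFunctor.supOver_le {M : Model T} (h : (X.obj M).Nonempty) {b : M.str.Pt y} {r : ℝ}
    (hr : ∀ a ∈ X.obj M, ψ.interp M (a.append b) ≤ r) : X.supOver c ψ.interp M b ≤ r := by
  rw [TFunctor.supOver, if_pos h]
  exact csSup_le (h.image _) (by rintro _ ⟨a, ha, rfl⟩; exact hr a ha)

theorem TFunctor.exists_lt_of_lt_supOver {M : Model T} (h : (X.obj M).Nonempty) {b : M.str.Pt y}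
    {r : ℝ} (hr : r < X.supOver c ψ.interp M b) :
    ∃ a ∈ X.obj M, r < ψ.interp M (a.append b) := by
  rw [TFunctor.supOver, if_pos h] at hr
  obtain ⟨_, ⟨a, ha, rfl⟩, h⟩ := exists_lt_of_lt_csSup (h.image _) hr
  exact ⟨a, ha, h⟩

theorem TFunctor.exists_bound_supOver :
    ∃ B : ℝ, ∀ (M : Model T) (b : M.str.Pt y), |X.supOver c ψ.interp M b| ≤ B := by
  obtain ⟨B, hB⟩ := ψ.exists_bound
  refine ⟨max B |c|, fun M b => ?_⟩
  by_cases h : (X.obj M).Nonempty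
  · refine le_max_of_le_left (abs_le.mpr ⟨?_, X.supOver_le c ψ h fun a _ => (abs_le.mp (hB M _)).2⟩)
    obtain ⟨a, ha⟩ := h
    exact (abs_le.mp (hB M _)).1.trans (X.le_supOver c ψ ha b)
  · rw [X.supOver_of_not_nonempty c ψ h]
    exact le_max_right _ _

variable {X}

/-- Every point of `X` in the ultraproduct is represented by points of `X(M i)`, which bounds its
supremum by the limit; families of points within `ε` of the suprema have classes in `X`, which gives
the converse bound. -/
theorem TFunctor.CommutesUltraprod.tendsto_supOver (hX : X.CommutesUltraprod) {I : Type u}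
    (U : Ultrafilter I) (M : I → Model T) (b : (i : I) → (M i).str.Pt y) :
    Tendsto (fun i => X.supOver c ψ.interp (M i) (b i)) U
      (𝓝 (X.supOver c ψ.interp (Model.ultraproduct U M) (uPt U b))) := by
  by_cases hne : (X.obj (Model.ultraproduct U M)).Nonempty
  · obtain ⟨B, hB⟩ := X.exists_bound_supOver c ψ
    have hT := tendsto_uLim U fun i => hB (M i) (b i)
    have hne' := hX.nonempty_iff.mp hne
    have hψ : ∀ a : (i : I) → (M i).str.Pt x,
        Tendsto (fun i => ψ.interp (M i) ((a i).append (b i))) U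
          (𝓝 (ψ.interp (Model.ultraproduct U M) (Struc.Pt.append (uPt U a) (uPt U b)))) := by
      intro a
      have := ψ.tendsto_interp U M fun i => (a i).append (b i)
      rwa [← uPt_append] at this
    convert hT using 2
    apply le_antisymm
    · refine X.supOver_le c ψ hne fun q hq => ?_
      obtain ⟨a, ha, rfl⟩ := hX.exists_rep hq
      refine le_of_tendsto_of_tendsto (hψ a) hT ?_
      filter_upwards [ha] with i hi
      exact X.le_supOver c ψ hi (b i)
    · refine le_of_forall_pos_le_add fun ε hε => ?_
      have hex : ∀ i, ∃ a : (M i).str.Pt x, (X.obj (M i)).Nonempty → a ∈ X.obj (M i) ∧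
          X.supOver c ψ.interp (M i) (b i) - ε < ψ.interp (M i) (a.append (b i)) := by
        intro i
        by_cases hi : (X.obj (M i)).Nonempty
        · obtain ⟨a, ha⟩ := X.exists_lt_of_lt_supOver c ψ hi (sub_lt_self _ hε)
          exact ⟨a, fun _ => ha⟩
        · exact ⟨fun k => Classical.arbitrary _, fun h => (hi h).elim⟩
      choose a ha using hex
      have h1 := X.le_supOver c ψ (hX.mem (hne'.mono fun i hi => (ha i hi).1)) (uPt U b)
      have h2 := le_of_tendsto_of_tendsto (hT.sub_const ε) (hψ a)
        (hne'.mono fun i hi => (ha i hi).2.le)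
      linarith
  · have h : ∀ᶠ i in (U : Filter I), ¬ (X.obj (M i)).Nonempty :=
      Ultrafilter.eventually_not.mpr fun h => hne (hX.nonempty_iff.mpr h)
    refine tendsto_const_nhds.congr' ?_
    filter_upwards [h] with i hi
    exact (X.supOver_of_not_nonempty c ψ hne _).trans (X.supOver_of_not_nonempty c ψ hi _).symm

/-- `N` embeds elementarily into an ultrapower of `M`, so `X` is nonempty there, hence at almost all
factors, each of which is `M`. -/
theorem TFunctor.CommutesUltraprod.nonempty_of_equiv (hX : X.CommutesUltraprod) {M N : Model T}
    {b : M.str.Pt y} {b' : N.str.Pt y}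
    (h : ∀ φ : Formula L y, φ.interp M.str b = φ.interp N.str b')
    (hN : (X.obj N).Nonempty) : (X.obj M).Nonempty := by
  obtain ⟨I, U, f, -⟩ := exists_elemEmb_ultrapower h
  obtain ⟨a, ha⟩ := hN
  obtain ⟨_, hi⟩ := (hX.nonempty_iff.mp
    ⟨_, X.map_mem N (Model.ultraproduct U fun _ => M) f a ha⟩).exists
  exact hi

theorem TFunctor.CommutesUltraprod.supOver_le_of_equiv (hX : X.CommutesUltraprod) {M N : Model T}
    {b : M.str.Pt y} {b' : N.str.Pt y}
    (h : ∀ φ : Formula L y, φ.interp M.str b = φ.interp N.str b') (hN : (X.obj N).Nonempty) :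
    X.supOver c ψ.interp N b' ≤ X.supOver c ψ.interp M b := by
  obtain ⟨I, U, f, hf⟩ := exists_elemEmb_ultrapower h
  let M' : Model T := Model.ultraproduct U fun _ => M
  -- Passing to the ultrapower does not change the supremum: it is the limit of a constant family.
  have hM' : X.supOver c ψ.interp M' (uPt U fun _ => b) = X.supOver c ψ.interp M b :=
    tendsto_nhds_unique (hX.tendsto_supOver c ψ U (fun _ => M) fun _ => b) tendsto_const_nhds
  refine X.supOver_le c ψ hN fun a ha => ?_
  have h1 := X.le_supOver c ψ (X.map_mem N M' f a ha) (uPt U fun _ => b)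
  have h2 := TFormula.interp_map (N := M') f ψ (a.append b')
  have h3 : (fun i => f.toFun (Sum.elim x y i) (a.append b' i)) =
      Struc.Pt.append (M := M'.str) (fun i => f.toFun (x i) (a i)) (uPt U fun _ => b) := by
    rw [← hf]
    funext i
    rcases i with i | i <;> rfl
  rw [← h2, h3, ← hM']
  exact h1

theorem TFunctor.CommutesUltraprod.realized_supOver (hX : X.CommutesUltraprod) :
    (X.supOver c ψ.interp).Realized := by
  refine TFunction.realized_of_tendsto (fun M N b b' h => ?_) fun I U M b =>
    hX.tendsto_supOver c ψ U M b
  by_cases hN : (X.obj N).Nonempty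
  · have hM := hX.nonempty_of_equiv h hN
    exact le_antisymm (hX.supOver_le_of_equiv c ψ (fun φ => (h φ).symm) hM)
      (hX.supOver_le_of_equiv c ψ h hN)
  · have hM : ¬ (X.obj M).Nonempty := fun hM => hN (hX.nonempty_of_equiv (fun φ => (h φ).symm) hM)
    rw [X.supOver_of_not_nonempty c ψ hM, X.supOver_of_not_nonempty c ψ hN]

/-- Follows from the supremum of `-ψ`, taken with default `-c` so that the final negation restores
`c`. -/
theorem TFunctor.CommutesUltraprod.realized_infOver (hX : X.CommutesUltraprod) :
    (X.infOver c ψ.interp).Realized := by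
  obtain ⟨ψ', hψ'⟩ := ψ.exists_comp continuous_neg
  obtain ⟨χ, hχ⟩ := hX.realized_supOver (-c) ψ'
  obtain ⟨θ, hθ⟩ := χ.exists_comp continuous_neg
  refine ⟨θ, fun M b => ?_⟩
  rw [hθ, hχ, TFunctor.supOver, TFunctor.infOver]
  split_ifs with h
  · rw [Real.sInf_def, ← image_neg_eq_neg, image_image]
    simp only [hψ']
  · exact neg_neg c

end Sup

/-! ### The distance to `X` -/

section Distance

variable {c : ℝ}

theorem TFunctor.bddBelow_dist (X : TFunctor T x) (M : Model T) (b : M.str.Pt x) :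
    BddBelow ((fun a : M.str.Pt x => dist a b) '' X.obj M) :=
  ⟨0, by rintro _ ⟨a, -, rfl⟩; exact dist_nonneg⟩

theorem TFunctor.nonneg_distTo (hc : 0 < c) : (X.distTo c).Nonneg := by
  intro M b
  rw [TFunctor.distTo]
  split_ifs with h
  · exact le_csInf (h.image _) (by rintro _ ⟨a, -, rfl⟩; exact dist_nonneg)
  · exact hc.le

theorem TFunctor.distTo_eq_zero_of_mem {M : Model T} {b : M.str.Pt x} (hb : b ∈ X.obj M) :
    X.distTo c M b = 0 := by
  rw [TFunctor.distTo, if_pos ⟨b, hb⟩]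
  refine le_antisymm (csInf_le (X.bddBelow_dist M b) ⟨b, hb, dist_self b⟩)
    (le_csInf ⟨_, b, hb, rfl⟩ (by rintro _ ⟨a, -, rfl⟩; exact dist_nonneg))

/-- A value below `ε ≤ c` cannot be the default `c`, so `X(M)` is nonempty. -/
theorem TFunctor.exists_dist_lt {M : Model T} {b : M.str.Pt x} {ε : ℝ} (hεc : ε ≤ c)
    (hb : X.distTo c M b < ε) : ∃ a ∈ X.obj M, dist b a < ε := by
  rw [TFunctor.distTo] at hb
  split_ifs at hb with h
  · obtain ⟨_, ⟨a, ha, rfl⟩, h⟩ := exists_lt_of_csInf_lt (h.image _) hb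
    exact ⟨a, ha, by rwa [dist_comm]⟩
  · linarith

theorem TFunctor.distTo_eq_zero_iff (hc : 0 < c) {M : Model T} {b : M.str.Pt x} :
    X.distTo c M b = 0 ↔ b ∈ X.obj M := by
  refine ⟨fun h => ?_, TFunctor.distTo_eq_zero_of_mem⟩
  rw [← (X.isClosed M).closure_eq, Metric.mem_closure_iff]
  intro ε hε
  obtain ⟨a, ha, h⟩ := TFunctor.exists_dist_lt (min_le_right ε c)
    (h.trans_lt (lt_min hε hc))
  exact ⟨a, ha, h.trans_le (min_le_left _ _)⟩

/-- The distance to a set, when realized, is an almost-near formula for it. -/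
theorem TFunctor.exists_almostNear_of_realized_distTo (hc : 0 < c)
    (h : (X.distTo c).Realized) :
    ∃ φ : TFormula T x, φ.interp.AlmostNear ∧ X.IsZerosetOf φ := by
  obtain ⟨φ, hφ⟩ := h
  -- Capping `δ` at `c` rules out models where `X` is empty.
  refine ⟨φ, ⟨fun M a => (hφ M a).symm ▸ TFunctor.nonneg_distTo hc M a, fun ε hε =>
    ⟨min ε c, lt_min hε hc, fun M a ha => ?_⟩⟩, fun M => ?_⟩
  · rw [hφ] at ha
    obtain ⟨b, hb, hab⟩ := TFunctor.exists_dist_lt (min_le_right ε c) ha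
    exact ⟨b, (hab.le.trans (min_le_left _ _)), by
      rw [hφ]; exact TFunctor.distTo_eq_zero_of_mem hb⟩
  · ext a
    exact (TFunctor.distTo_eq_zero_iff hc).symm.trans (by rw [← hφ]; rfl)

/-- The case `ψ = d(x, y)`, with `y` a second copy of `x`. -/
theorem TFunctor.realized_distTo_of_realized_infOver
    (h : ∀ ψ : TFormula T (Sum.elim x x), (X.infOver c ψ.interp).Realized) :
    (X.distTo c).Realized := by
  obtain ⟨φ, hφ⟩ := exists_dist_formula T x
  obtain ⟨χ, hχ⟩ := h φ
  refine ⟨χ, fun M b => ?_⟩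
  rw [hχ, TFunctor.infOver, TFunctor.distTo]
  simp only [hφ]

end Distance

/-! ### Almost-nearness and ultraproducts -/

/-- Zerosets of almost-near formulae commute with ultraproducts. -/
theorem TFunctor.commutesUltraprod_of_almostNear {φ : TFormula T x} (hφ : φ.interp.AlmostNear)
    (hX : X.IsZerosetOf φ) : X.CommutesUltraprod := by
  intro I M U
  ext q
  constructor
  · intro hq
    rw [hX.mem_iff] at hq
    obtain ⟨a, rfl⟩ : ∃ a : (i : I) → (M i).str.Pt x, uPt U (M := fun i => (M i).str) a = q :=
      ⟨fun i k => uRep (q k) i, funext fun k => uMk_uRep U _ (q k)⟩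
    have hlim : Tendsto (fun i => φ.interp (M i) (a i)) U (𝓝 0) := by
      have := φ.tendsto_interp U M a
      rwa [hq] at this
    have hnear : ∀ ε > 0, ∀ᶠ i in (U : Filter I), ∃ b ∈ X.obj (M i), dist (a i) b ≤ ε := by
      intro ε hε
      obtain ⟨δ, hδ, h⟩ := hφ.2 ε hε
      filter_upwards [hlim.eventually_lt_const hδ] with i hi
      obtain ⟨b, hb, hb0⟩ := h (M i) (a i) hi
      exact ⟨b, hX.mem_iff.mpr hb0, hb⟩
    -- One family must serve every `ε`, so `b i` is chosen within twice the distance from `a i` to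
    -- `X(M i)`. If that distance is `0`, closedness puts `a i` itself in `X(M i)`.
    have hex : ∀ i, ∃ b : (M i).str.Pt x, (X.obj (M i)).Nonempty → b ∈ X.obj (M i) ∧
        dist (a i) b ≤ 2 * Metric.infDist (a i) (X.obj (M i)) := by
      intro i
      by_cases hne : (X.obj (M i)).Nonempty
      · rcases (Metric.infDist_nonneg (x := a i) (s := X.obj (M i))).eq_or_lt with h0 | h0
        · refine ⟨a i, fun _ => ⟨((X.isClosed _).mem_iff_infDist_zero hne).2 h0.symm, ?_⟩⟩
          rw [dist_self, ← h0, mul_zero]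
        · obtain ⟨b, hb, h⟩ := (Metric.infDist_lt_iff (r := 2 * Metric.infDist (a i) (X.obj (M i)))
            hne).1 (by linarith)
          exact ⟨b, fun _ => ⟨hb, h.le⟩⟩
      · exact ⟨a i, fun h => (hne h).elim⟩
    choose b hb using hex
    have hne : ∀ᶠ i in (U : Filter I), (X.obj (M i)).Nonempty :=
      (hnear 1 one_pos).mono fun i ⟨b, hb, _⟩ => ⟨b, hb⟩
    refine ⟨b, hne.mono fun i hi => (hb i hi).1, ?_⟩
    refine dist_le_zero.mp (le_of_forall_pos_le_add fun ε hε => ?_)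
    rw [zero_add]
    refine le_of_tendsto (tendsto_dist_uPt U (fun i => (M i).str) a b) ?_
    filter_upwards [hne, hnear (ε / 2) (half_pos hε)] with i hi hni
    obtain ⟨d, hd, hda⟩ := hni
    have := (Metric.infDist_le_dist_of_mem hd).trans hda
    linarith [(hb i hi).2]
  · rintro ⟨a, ha, rfl⟩
    refine hX.mem_iff.mpr ?_
    refine tendsto_nhds_unique (φ.tendsto_interp U M a) (tendsto_const_nhds.congr' ?_)
    filter_upwards [ha] with i hi
    exact (hX.mem_iff.mp hi).symm

/-- If a zeroset commutes with ultraproducts, every nonnegative formula defining it is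
almost-near. -/
theorem TFunctor.CommutesUltraprod.almostNear (hX : X.CommutesUltraprod) {φ : TFormula T x}
    (h0 : φ.interp.Nonneg) (hφ : X.IsZerosetOf φ) : φ.interp.AlmostNear := by
  refine ⟨h0, fun ε hε => ?_⟩
  by_contra! hcon
  -- For each `k`, a tuple with value below `1 / (k + 1)` and no zero within `ε`. The `ULift` places
  -- the index set in the universe of the ultraproducts.
  choose M a ha hfar using fun k : ULift.{u} ℕ =>
    hcon (1 / (k.down + 1 : ℝ)) (by positivity)
  let U : Ultrafilter (ULift.{u} ℕ) := Filter.hyperfilter _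
  have hdown : Tendsto (ULift.down : ULift.{u} ℕ → ℕ) U atTop := by
    rw [← Nat.cofinite_eq_atTop]
    exact ULift.down_injective.tendsto_cofinite.mono_left Filter.hyperfilter_le_cofinite
  have hlim : Tendsto (fun k => φ.interp (M k) (a k)) U (𝓝 0) :=
    squeeze_zero (fun k => h0 _ _) (fun k => (ha k).le)
      (tendsto_one_div_add_atTop_nhds_zero_nat.comp hdown)
  have hmem : uPt U a ∈ X.obj (Model.ultraproduct U M) :=
    hφ.mem_iff.mpr (tendsto_nhds_unique (φ.tendsto_interp U M a) hlim)
  -- The class of `a` is a zero of `φ`, hence also the class of a family `b` of true zeros. Then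
  -- `d(a k, b k)` tends to `0` along `U`, against `hfar`.
  obtain ⟨b, hb, hab⟩ := hX.exists_rep hmem
  have hd := tendsto_dist_uPt U (fun k => (M k).str) a b
  rw [← hab, dist_self] at hd
  obtain ⟨k, hk, hbk⟩ := ((hd.eventually_lt_const hε).and hb).exists
  exact hfar k (b k) hk.le (hφ.mem_iff.mp hbk)

end Definable

end ContLogic

theorem mainTheorem1 {L : ContLogic.Signature.{u}} (T : ContLogic.Theory L)
    {n : ℕ} (x : Fin n → L.Sorts) (X : ContLogic.TFunctor T x)
    (cSup cInf : ℝ) (hcInf : 0 < cInf) :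
    List.TFAE [
      ∀ (m : ℕ) (y : Fin m → L.Sorts) (ψ : ContLogic.TFormula T (Sum.elim x y)),
        (X.supOver cSup (ContLogic.TFormula.interp ψ)).Realized ∧
        (X.infOver cInf (ContLogic.TFormula.interp ψ)).Realized,
      (X.distTo cInf).Realized,
      ∃ φ : ContLogic.TFormula T x,
        (ContLogic.TFormula.interp φ).AlmostNear ∧ X.IsZerosetOf φ,
      ∀ (I : Type u) (M : I → ContLogic.Model T) (U : Ultrafilter I),
        X.obj (ContLogic.Model.ultraproduct U M) = X.ultraprod U M,
      (∃ φ : ContLogic.TFormula T x, X.IsZerosetOf φ) ∧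
        ∀ φ : ContLogic.TFormula T x, (ContLogic.TFormula.interp φ).Nonneg →
          X.IsZerosetOf φ → (ContLogic.TFormula.interp φ).AlmostNear] := by
  have h41 : X.CommutesUltraprod →
      ∀ (m : ℕ) (y : Fin m → L.Sorts) (ψ : ContLogic.TFormula T (Sum.elim x y)),
        (X.supOver cSup (ContLogic.TFormula.interp ψ)).Realized ∧
        (X.infOver cInf (ContLogic.TFormula.interp ψ)).Realized :=
    fun h m y ψ => ⟨h.realized_supOver cSup ψ, h.realized_infOver cInf ψ⟩
  tfae_have 1 → 2 := fun h =>
    ContLogic.TFunctor.realized_distTo_of_realized_infOver fun ψ => (h n x ψ).2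
  tfae_have 2 → 3 := ContLogic.TFunctor.exists_almostNear_of_realized_distTo hcInf
  tfae_have 3 → 4 := fun ⟨_, h, h'⟩ => ContLogic.TFunctor.commutesUltraprod_of_almostNear h h'
  tfae_have 4 → 1 := h41
  tfae_have 5 → 3 := by
    rintro ⟨⟨φ, hφ⟩, h⟩
    -- A formula defining the zeroset may take negative values; its absolute value has the same
    -- zeros and is nonnegative.
    obtain ⟨χ, hχ⟩ := φ.exists_comp continuous_abs
    have hX : X.IsZerosetOf χ := fun M => by
      ext a
      exact hφ.mem_iff.trans (abs_eq_zero.symm.trans (by rw [← hχ]; rfl))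
    exact ⟨χ, h χ (fun M a => (hχ M a).symm ▸ abs_nonneg _) hX, hX⟩
  tfae_have 4 → 5 := by
    intro h
    -- That `X` is a zeroset is obtained through the distance formula, by way of 1, 2 and 3.
    obtain ⟨φ, -, hφ⟩ := tfae_2_to_3 (tfae_1_to_2 (h41 h))
    exact ⟨⟨φ, hφ⟩, fun χ h0 hχ => ContLogic.TFunctor.CommutesUltraprod.almostNear h h0 hχ⟩
  tfae_finish
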